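/- **Setting.** Let $V$ be a countable set, $(\mathfrak h_i)_{i\in V}$ separable complex Hilbert spaces and $\mathcal H=\bigoplus_{i\in V}\mathfrak h_i$ (Hilbert sum); for $x\in\mathfrak h_i$ write $x\otimes\vec i$ for the corresponding vector of $\mathcal H$. Let $L_{i,j}:\mathfrak h_j\to\mathfrak h_i$ $(i,j\in V)$ be bounded operators with $\sum_{i}L_{i,j}^*L_{i,j}=\mathrm{Id}$ strongly for every $j$, put $A_{i,j}=L_{i,j}\otimes|i\rangle\langle j|$ (an operator on $\mathcal H$), and let $$\mathfrak M(\rho)=\sum_{i,j\in V}A_{i,j}\,\rho\,A_{i,j}^*$$ be the associated open quantum random walk on the trace-class operators of $\mathcal H$. A state is a positive trace-class operator of trace $1$; it is invariant if $\mathfrak M(\rho)=\rho$. The support $\mathrm{supp}\,\rho$ of a positive operator is the closure of its range. An enclosure is a closed subspace $\mathcal V\subset\mathcal H$ such that, for every positive trace-class $\rho$, $\mathrm{supp}\,\rho\subset\mathcal V$ implies $\mathrm{supp}\,\mathfrak M(\rho)\subset\mathcal V$; a minimal enclosure is a nonzero enclosure containing no other nonzero enclosure. For $\phi=\sum_i\phi_i\otimes\vec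 i\in\mathcal H$, $\mathrm{Enc}(\phi)$ is the closed linear span of the vectors $L_\pi\phi_i\otimes\vec j$, where $\pi=(i_0,\dots,i_\ell)$ runs over all finite sequences in $V$ with $i_0=i$, $i_\ell=j$, $\ell\ge0$, and $L_\pi=L_{i_\ell,i_{\ell-1}}\cdots L_{i_1,i_0}$ ($=\mathrm{Id}$ if $\ell=0$). Let $\mathcal R$ be the closed span of the supports of all invariant states and $\mathcal D=\mathcal R^\perp$. Write $P_{\mathcal V}$ for the orthogonal projection onto $\mathcal V$. Fix an orthogonal decomposition $$\mathcal H=\mathcal D\oplus\bigoplus_{\alpha\in A}E_\alpha\oplus\bigoplus_{\beta\in B}\bigoplus_{\gamma\in C_\beta}E_{\beta,\gamma},\qquad E_\alpha=\mathrm{Enc}(x_\alpha\otimes\vec{i_\alpha}),\quad E_{\beta,\gamma}=\mathrm{Enc}(x_{\beta,\gamma}\otimes\vec{i_{\beta,\gamma}}),$$ in which every $E_\alpha$ and every $E_{\beta,\gamma}$ is a minimal enclosure, every $C_\beta$ has at least two elements, and * for $\alpha\in A$, the only minimal enclosure not orthogonal to $E_\alpha$ is $E_\alpha$ itself; * for $\beta\in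 B$ and $\gamma\in C_\beta$, every minimal enclosure not orthogonal to $E_{\beta,\gamma}$ is contained in $\bigoplus_{\gamma'\in C_\beta}E_{\beta,\gamma'}$; * each family $C_\beta$ is minimal with this property: for no nonempty $S\subsetneq C_\beta$ is it true that, for all $\gamma\in S$, every minimal enclosure not orthogonal to $E_{\beta,\gamma}$ is contained in $\bigoplus_{\gamma'\in S}E_{\beta,\gamma'}$. For indices $k,l$ in $\{0\}\cup A\cup\{(\beta,\gamma):\beta\in B,\gamma\in C_\beta\}$ let $P_0=P_{\mathcal D}$, $P_k=P_{E_k}$ for $k\neq0$, and $\rho_{k,l}=P_k\,\rho\,P_l$. **Theorem.** For every $k\in A\cup\{(\beta,\gamma)\}$ there is exactly one invariant state $\rho^{\mathrm{inv}}_k$ with support contained in $E_k$, and its support is $E_k$. For all $\beta\in B$ and $\gamma\ne\gamma'$ in $C_\beta$ there is an operator $Q=Q_{(\beta,\gamma,\gamma')}$ with $Q^*Q=P_{E_{\beta,\gamma}}$ and $QQ^*=P_{E_{\beta,\gamma'}}$ (a partial isometry from $E_{\beta,\gamma}$ onto $E_{\beta,\gamma'}$), independent of $\rho$ below, such that $$\rho^{\mathrm{inv}}_{(\beta,\gamma')}=Q\,\rho^{\mathrm{inv}}_{(\beta,\gamma)}\,Q^*,\qquad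 Q^*\rho^{\mathrm{inv}}_{(\beta,\gamma')}=\rho^{\mathrm{inv}}_{(\beta,\gamma)}Q^*,$$ and every invariant state $\rho$ satisfies: 1. $\rho_{0,0}=0$; 2. $\rho_{\alpha,\alpha}$ is proportional to $\rho^{\mathrm{inv}}_\alpha$ for every $\alpha\in A$; 3. $\rho_{(\beta,\gamma),(\beta,\gamma)}$ is proportional to $\rho^{\mathrm{inv}}_{(\beta,\gamma)}$ for all $\beta\in B$, $\gamma\in C_\beta$; 4. for $\gamma\neq\gamma'$ in $C_\beta$, the block $\rho_{(\beta,\gamma),(\beta,\gamma')}$ is a trace-class operator fixed by $\mathfrak M$ and is proportional to $Q_{(\beta,\gamma,\gamma')}^*\,\rho^{\mathrm{inv}}_{(\beta,\gamma')}$; 5. all other blocks $\rho_{k,l}$ with $k\neq l$ are zero. Moreover, the blocks in 4 can be nonzero: for all $\beta\in B$ and $\gamma\ne\gamma'$ in $C_\beta$ there is an invariant state $\rho$ with $\rho_{(\beta,\gamma),(\beta,\gamma')}\neq0$. -/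

import Mathlib

open scoped InnerProductSpace ENNReal

noncomputable section

namespace OQRWalk

/-! ### Trace-class operators, states and supports on a Hilbert space -/

section Hilbert

variable {H : Type*} [NormedAddCommGroup H] [InnerProductSpace ℂ H] [CompleteSpace H]

/-- The operator `T` has trace `t`: in every Hilbert basis `(b k)` the series of diagonal entries
`∑ k, ⟪b k, T (b k)⟫` converges unconditionally to `t`. -/
def HasTrace (T : H →L[ℂ] H) (t : ℂ) : Prop :=
  ∀ (w : Set H) (b : HilbertBasis w ℂ H), HasSum (fun k => ⟪b k, T (b k)⟫_ℂ) t

/-- `T` is trace class: its absolute value `|T| = (T* T) ^ (1/2)` has a (finite) trace. -/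
def IsTraceClass (T : H →L[ℂ] H) : Prop :=
  ∃ t : ℂ, HasTrace (CFC.abs T) t

/-- A state: a positive trace-class operator of trace one. -/
def IsState (ρ : H →L[ℂ] H) : Prop :=
  ρ.IsPositive ∧ IsTraceClass ρ ∧ HasTrace ρ 1

/-- The support of a positive operator: the closure of its range. -/
def supp (ρ : H →L[ℂ] H) : Submodule ℂ H :=
  (LinearMap.range (ρ : H →ₗ[ℂ] H)).topologicalClosure

/-- The orthogonal projection of `H` onto (the closure of) the subspace `K`. -/
def proj (K : Submodule ℂ H) : H →L[ℂ] H :=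
  K.topologicalClosure.starProjection

/-- `Q` is a partial isometry from `E` onto `F`: `Q* Q = P_E` and `Q Q* = P_F`. -/
def IsPartialIsometryBetween (Q : H →L[ℂ] H) (E F : Submodule ℂ H) : Prop :=
  Q.adjoint ∘L Q = proj E ∧ Q ∘L Q.adjoint = proj F

end Hilbert

/-! ### Open quantum random walks -/

/-- An open quantum random walk on the vertex set `V` with internal spaces `h i`: transition
operators `L i j : h j → h i` (from the site `j` to the site `i`) such that
`∑ i, (L i j)* (L i j) = Id` strongly, for every `j`. -/
structure OQRW {V : Type*} (h : V → Type*) [∀ i, NormedAddCommGroup (h i)]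
    [∀ i, InnerProductSpace ℂ (h i)] [∀ i, CompleteSpace (h i)] where
  L : ∀ i j : V, h j →L[ℂ] h i
  stochastic : ∀ (j : V) (x : h j), HasSum (fun i => (L i j).adjoint (L i j x)) x

/-- Finite sequences of sites `i = i₀, i₁, …, i_ℓ = j`, including the sequence reduced to `i`. -/
inductive Path {V : Type*} (i : V) : V → Type _
  | nil : Path i i
  | snoc {j : V} (p : Path i j) (k : V) : Path i k

section Walk

variable {V : Type*} {h : V → Type*} [∀ i, NormedAddCommGroup (h i)]
  [∀ i, InnerProductSpace ℂ (h i)]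

/-- The Hilbert space `⨁ i, h i` (the Hilbert sum of the internal spaces). -/
abbrev Space (h : V → Type*) [∀ i, NormedAddCommGroup (h i)]
    [∀ i, InnerProductSpace ℂ (h i)] : Type _ :=
  lp h 2

open Classical in
/-- The inclusion `x ↦ x ⊗ i` of `h i` into the Hilbert sum. -/
def site (i : V) : h i →L[ℂ] Space h :=
  lp.singleContinuousLinearMap ℂ h 2 i

/-- The component of a vector of the Hilbert sum at the site `i`. -/
def comp (i : V) : Space h →L[ℂ] h i :=
  lp.evalCLM ℂ h 2 i

variable [∀ i, CompleteSpace (h i)]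

namespace OQRW

variable (M : OQRW h)

/-- The operator `A_{i,j} = L_{i,j} ⊗ |i⟩⟨j|` on the Hilbert sum. -/
def kraus (i j : V) : Space h →L[ℂ] Space h :=
  site i ∘L M.L i j ∘L comp j

/-- The map `ρ ↦ ∑_{i,j} A_{i,j} ρ A_{i,j}*`. For a trace-class `ρ` the series converges absolutely
in trace norm, hence also in the operator norm, in which the sum is taken here. -/
def map (ρ : Space h →L[ℂ] Space h) : Space h →L[ℂ] Space h :=
  ∑' p : V × V, M.kraus p.1 p.2 ∘L ρ ∘L (M.kraus p.1 p.2).adjoint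

/-- A trace-class operator that is fixed by the walk. -/
def IsInvariant (X : Space h →L[ℂ] Space h) : Prop :=
  IsTraceClass X ∧ M.map X = X

/-- An invariant state of the walk. -/
def IsInvariantState (ρ : Space h →L[ℂ] Space h) : Prop :=
  IsState ρ ∧ M.map ρ = ρ

/-- `ρ` is the unique invariant state of the restriction of the walk to the trace-class operators
living on `E`. -/
def IsUniqueInvariantStateOn (E : Submodule ℂ (Space h)) (ρ : Space h →L[ℂ] Space h) : Prop :=
  (M.IsInvariantState ρ ∧ supp ρ ≤ E) ∧
    ∀ σ : Space h →L[ℂ] Space h, M.IsInvariantState σ → supp σ ≤ E → σ = ρ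

/-- The operator `L_π = L_{i_ℓ,i_{ℓ-1}} ⋯ L_{i₁,i₀}` of a path; it is `Id` on the path reduced to
one site. -/
def pathOp {i : V} : {j : V} → Path i j → (h i →L[ℂ] h j)
  | _, .nil => ContinuousLinearMap.id ℂ (h i)
  | _, .snoc (j := j) p k => M.L k j ∘L pathOp p

/-- `Enc(φ)`: the closed linear span of the vectors `(L_π ⊗ |j⟩⟨i|) φ`, `π` a path from `i` to
`j`. -/
def enc (φ : Space h) : Submodule ℂ (Space h) :=
  (Submodule.span ℂ {ψ | ∃ (i j : V) (π : Path i j),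
    ψ = site j (M.pathOp π (comp i φ))}).topologicalClosure

/-- An enclosure: a closed subspace `K` such that `supp ρ ⊆ K` implies `supp (map ρ) ⊆ K` for every
positive trace-class operator `ρ`. -/
def IsEnclosure (K : Submodule ℂ (Space h)) : Prop :=
  IsClosed (K : Set (Space h)) ∧
    ∀ ρ : Space h →L[ℂ] Space h, ρ.IsPositive → IsTraceClass ρ → supp ρ ≤ K → supp (M.map ρ) ≤ K

/-- A minimal enclosure: a nonzero enclosure that contains no other nonzero enclosure. -/
def IsMinimalEnclosure (K : Submodule ℂ (Space h)) : Prop :=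
  M.IsEnclosure K ∧ K ≠ ⊥ ∧ ∀ K', M.IsEnclosure K' → K' ≤ K → K' ≠ ⊥ → K' = K

/-- The fast recurrent space: the closed span of the supports of all invariant states. -/
def recurrentSpace : Submodule ℂ (Space h) :=
  (⨆ (ρ : Space h →L[ℂ] Space h) (_ : M.IsInvariantState ρ), supp ρ).topologicalClosure

/-- The space `𝒟`, orthogonal complement of the fast recurrent space. -/
def decaySpace : Submodule ℂ (Space h) :=
  M.recurrentSpaceᗮ

end OQRW

/-! ### Decompositions into minimal enclosures -/

/-- The generating vectors `x_a ⊗ i_a` (`a ∈ A`) and `x_{b,c} ⊗ i_{b,c}` (`b ∈ B`, `c ∈ C b`) of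
the enclosures of a decomposition. -/
structure Generators (h : V → Type*) (A B : Type*) (C : B → Type*) where
  siteA : A → V
  vecA : ∀ a, h (siteA a)
  siteB : ∀ b, C b → V
  vecB : ∀ b (c : C b), h (siteB b c)

/-- The index set `{0} ∪ A ∪ {(b, c) | b ∈ B, c ∈ C b}` of the blocks of a decomposition. -/
inductive Block (A B : Type*) (C : B → Type*)
  | zero : Block A B C
  | single (a : A) : Block A B C
  | family (b : B) (c : C b) : Block A B C

namespace Generators

variable {A B : Type*} {C : B → Type*} (G : Generators h A B C) (M : OQRW h)

/-- The enclosure `Enc(x_a ⊗ i_a)`. -/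
def encA (a : A) : Submodule ℂ (Space h) :=
  M.enc (site (G.siteA a) (G.vecA a))

/-- The enclosure `Enc(x_{b,c} ⊗ i_{b,c})`. -/
def encB (b : B) (c : C b) : Submodule ℂ (Space h) :=
  M.enc (site (G.siteB b c) (G.vecB b c))

/-- The closed sum of the enclosures `Enc(x_{b,c} ⊗ i_{b,c})` over `c ∈ S`. -/
def sumB (b : B) (S : Set (C b)) : Submodule ℂ (Space h) :=
  (⨆ c ∈ S, G.encB M b c).topologicalClosure

/-- The summands of the decomposition. -/
def space : Block A B C → Submodule ℂ (Space h)
  | .zero => M.decaySpace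
  | .single a => G.encA M a
  | .family b c => G.encB M b c

/-- The block `P_k ρ P_l` of an operator `ρ`. -/
def block (ρ : Space h →L[ℂ] Space h) (k l : Block A B C) : Space h →L[ℂ] Space h :=
  proj (G.space M k) ∘L ρ ∘L proj (G.space M l)

/-- Orthogonal decompositions
`H = 𝒟 ⊕ ⨁ a, Enc(x_a ⊗ i_a) ⊕ ⨁ b, ⨁ c, Enc(x_{b,c} ⊗ i_{b,c})` of the Hilbert space of a
walk into `𝒟` and minimal enclosures, sorted by their non-orthogonality to other ones. -/
structure IsDecomposition : Prop where
  orthogonal : Pairwise fun k l : Block A B C => G.space M k ⟂ G.space M l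
  total : (⨆ k, G.space M k).topologicalClosure = ⊤
  /-- Every family has at least two members. -/
  nontrivial_family : ∀ b, Nontrivial (C b)
  minimal_encA : ∀ a, M.IsMinimalEnclosure (G.encA M a)
  minimal_encB : ∀ b c, M.IsMinimalEnclosure (G.encB M b c)
  /-- The only minimal enclosure that is not orthogonal to `Enc(x_a ⊗ i_a)` is itself. -/
  isolated : ∀ (a : A) (K : Submodule ℂ (Space h)),
    M.IsMinimalEnclosure K → ¬ K ⟂ G.encA M a → K = G.encA M a
  /-- Every minimal enclosure that is not orthogonal to a member of a family is contained in the
  closed sum of that family. -/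
  closed_family : ∀ (b : B) (c : C b) (K : Submodule ℂ (Space h)),
    M.IsMinimalEnclosure K → ¬ K ⟂ G.encB M b c → K ≤ G.sumB M b Set.univ
  /-- The families are minimal: no proper nonempty part of a family has the preceding property. -/
  minimal_family : ∀ (b : B) (S : Set (C b)), S.Nonempty → S ≠ Set.univ →
    ¬ ∀ c ∈ S, ∀ K : Submodule ℂ (Space h),
      M.IsMinimalEnclosure K → ¬ K ⟂ G.encB M b c → K ≤ G.sumB M b S

end Generators

end Walk

end OQRWalk

end

/-! The argument is run for an arbitrary Kraus family `A` with `∑ A* A = 1`. By `isStable_iff`,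
enclosures are the closed subspaces stable under every `A p`. Write `R` for the closed span of the
supports of the fixed states.

Trace conservation does most of the work. If `E` is stable, no mass leaves `E`; for a fixed state
the mass outside `E` is constant, so none enters either (`proj_mul_kraus_mul_fixed`). Hence for `E ≤
R` both `E` and its complement in `R` are invariant, and `P_E` lies in `fixedCommutant A`, whose
elements multiply fixed states into fixed operators (`IsFixedState.mul_mul`). Trace conservation
also makes the positive part of a self-adjoint fixed operator fixed (`IsFixed.posPart`). Supports of
positive fixed operators are stable, so on a minimal `E` the positive and negative parts of a fixed
operator cannot both be nonzero: both supports would equal `E`, yet they are orthogonal. Thus the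
fixed operators on `E` form one line (`IsMinimalStable.exists_eq_smul`).

A Schur lemma follows: a nonzero element of the commutant from one minimal `E` to another minimal
`F` is a multiple of a partial isometry, an intertwiner. The graph `{x + Q x}` of an intertwiner
between orthogonal `E` and `F` is again a minimal enclosure, oblique to both
(`IsIntertwiner.exists_graph`). The sorting of the decomposition therefore forbids intertwiners
leaving an `E_α` or a family, while minimality of a family forces its members to be intertwined. A
nonzero off-diagonal block of a fixed state between the minimal summands yields an intertwiner,
which kills the blocks in 5; multiplying a block inside a family by `Q` brings it back to the
one-dimensional diagonal case. -/

set_option linter.unusedSectionVars false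

noncomputable section

namespace OQRWalk

/-! ### Hilbert-Schmidt norms, traces and the ideal of trace-class operators. -/

section HilbertSchmidt

variable {H : Type*} [NormedAddCommGroup H] [InnerProductSpace ℂ H] [CompleteSpace H]

lemma mul_apply_eq (S T : H →L[ℂ] H) (x : H) : (S * T) x = S (T x) := rfl

lemma inner_star_right (T : H →L[ℂ] H) (x y : H) : ⟪x, star T y⟫_ℂ = ⟪T x, y⟫_ℂ :=
  ContinuousLinearMap.adjoint_inner_right T x y

lemma inner_star_left (T : H →L[ℂ] H) (x y : H) : ⟪star T x, y⟫_ℂ = ⟪x, T y⟫_ℂ :=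
  ContinuousLinearMap.adjoint_inner_left T y x

lemma inner_star_mul_self (T : H →L[ℂ] H) (x : H) : ⟪x, (star T * T) x⟫_ℂ = ((‖T x‖ ^ 2 : ℝ) : ℂ) := by
  rw [mul_apply_eq, inner_star_right, inner_self_eq_norm_sq_to_K]
  norm_cast

lemma ofReal_norm_sq {E : Type*} [SeminormedAddCommGroup E] (x : E) :
    ENNReal.ofReal (‖x‖ ^ 2) = ‖x‖ₑ ^ 2 := by
  rw [ENNReal.ofReal_pow (norm_nonneg _), ofReal_norm]

lemma tsum_ofReal_of_hasSum {ι : Type*} {f : ι → ℝ} {a : ℝ} (hf : ∀ i, 0 ≤ f i)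
    (h : HasSum f a) : ∑' i, ENNReal.ofReal (f i) = ENNReal.ofReal a := by
  rw [← ENNReal.ofReal_tsum_of_nonneg hf h.summable, h.tsum_eq]

lemma tsum_enorm_inner_sq {ι : Type*} (b : HilbertBasis ι ℂ H) (x : H) :
    ∑' i, ‖⟪b i, x⟫_ℂ‖ₑ ^ 2 = ‖x‖ₑ ^ 2 := by
  have h := lp.hasSum_norm (p := 2) (by norm_num) (b.repr x)
  simp only [ENNReal.toReal_ofNat, Real.rpow_ofNat, LinearIsometryEquiv.norm_map,
    HilbertBasis.repr_apply_apply] at h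
  have := tsum_ofReal_of_hasSum (fun i => by positivity) h
  simpa only [ofReal_norm_sq] using this

variable (H) in
/-- A Hilbert basis fixed once and for all, in which traces are computed. -/
def refBasis : HilbertBasis (exists_hilbertBasis ℂ H).choose ℂ H :=
  (exists_hilbertBasis ℂ H).choose_spec.choose

/-- The square of the Hilbert-Schmidt norm. -/
def hsq (S : H →L[ℂ] H) : ℝ≥0∞ := ∑' k, ‖S (refBasis H k)‖ₑ ^ 2

/-- Parseval in both bases turns each side into the same double sum of squared matrix entries. Since
the bases are unrelated, this gives independence of the basis as well as invariance under the
adjoint. -/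
lemma tsum_enorm_sq_eq_tsum_star {ι κ : Type*} (b : HilbertBasis ι ℂ H) (c : HilbertBasis κ ℂ H)
    (S : H →L[ℂ] H) : ∑' k, ‖S (b k)‖ₑ ^ 2 = ∑' l, ‖star S (c l)‖ₑ ^ 2 := by
  calc ∑' k, ‖S (b k)‖ₑ ^ 2 = ∑' k, ∑' l, ‖⟪c l, S (b k)⟫_ℂ‖ₑ ^ 2 := by
        simp only [tsum_enorm_inner_sq]
    _ = ∑' l, ∑' k, ‖⟪b k, star S (c l)⟫_ℂ‖ₑ ^ 2 := by
        rw [ENNReal.tsum_comm]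
        refine tsum_congr fun l => tsum_congr fun k => ?_
        rw [inner_star_right, ← ofReal_norm, ← ofReal_norm, norm_inner_symm]
    _ = _ := by simp only [tsum_enorm_inner_sq]

lemma tsum_enorm_sq_eq_hsq {ι : Type*} (b : HilbertBasis ι ℂ H) (S : H →L[ℂ] H) :
    ∑' k, ‖S (b k)‖ₑ ^ 2 = hsq S := by
  rw [hsq, tsum_enorm_sq_eq_tsum_star b b, tsum_enorm_sq_eq_tsum_star (refBasis H) b]

lemma hsq_star (S : H →L[ℂ] H) : hsq (star S) = hsq S :=
  (tsum_enorm_sq_eq_tsum_star (refBasis H) (refBasis H) S).symm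

lemma enorm_apply_sq_le_hsq (S : H →L[ℂ] H) (x : H) : ‖S x‖ₑ ^ 2 ≤ hsq S * ‖x‖ₑ ^ 2 := by
  rw [← tsum_enorm_inner_sq (refBasis H) (S x), ← hsq_star, hsq, ← ENNReal.tsum_mul_right]
  refine ENNReal.tsum_le_tsum fun k => ?_
  rw [← inner_star_left, ← mul_pow]
  gcongr
  simp only [← ofReal_norm]
  rw [← ENNReal.ofReal_mul (norm_nonneg _)]
  exact ENNReal.ofReal_le_ofReal (norm_inner_le_norm _ _)

lemma eq_zero_of_hsq_eq_zero {S : H →L[ℂ] H} (h : hsq S = 0) : S = 0 := by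
  ext x
  have := enorm_apply_sq_le_hsq S x
  simpa [h] using this

lemma hsq_zero : hsq (0 : H →L[ℂ] H) = 0 := by simp [hsq]

lemma norm_sq_le_hsq (S : H →L[ℂ] H) : ENNReal.ofReal (‖S‖ ^ 2) ≤ hsq S := by
  by_cases h : hsq S = ∞
  · simp [h]
  have hS : ‖S‖ ≤ √ (hsq S).toReal := by
    refine S.opNorm_le_bound (Real.sqrt_nonneg _) fun x => ?_
    have h1 := enorm_apply_sq_le_hsq S x
    rw [← ofReal_norm_sq, ← ofReal_norm_sq, ← ENNReal.ofReal_toReal h,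
      ← ENNReal.ofReal_mul ENNReal.toReal_nonneg, ENNReal.ofReal_le_ofReal_iff (by positivity)] at h1
    rw [← abs_of_nonneg (norm_nonneg (S x))]
    refine (Real.abs_le_sqrt h1).trans ?_
    rw [Real.sqrt_mul ENNReal.toReal_nonneg, Real.sqrt_sq (norm_nonneg _)]
  rw [ENNReal.ofReal_le_iff_le_toReal h]
  calc ‖S‖ ^ 2 ≤ (√ (hsq S).toReal) ^ 2 := by gcongr
    _ = _ := Real.sq_sqrt ENNReal.toReal_nonneg

lemma hsq_mul_le (T S : H →L[ℂ] H) : hsq (T * S) ≤ ‖T‖ₑ ^ 2 * hsq S := by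
  rw [hsq, hsq, ← ENNReal.tsum_mul_left]
  refine ENNReal.tsum_le_tsum fun k => ?_
  rw [← mul_pow]
  gcongr
  exact T.le_opENorm _

lemma hsq_mul_ne_top (T : H →L[ℂ] H) {S : H →L[ℂ] H} (h : hsq S ≠ ∞) : hsq (T * S) ≠ ∞ :=
  ne_top_of_le_ne_top (ENNReal.mul_ne_top (by simp) h) (hsq_mul_le T S)

lemma hsq_mul_ne_top' {S : H →L[ℂ] H} (h : hsq S ≠ ∞) (T : H →L[ℂ] H) : hsq (S * T) ≠ ∞ := by
  rw [← hsq_star, star_mul]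
  exact hsq_mul_ne_top _ (by rwa [hsq_star])

/-- The trace of a positive operator, possibly infinite. -/
def ptr (T : H →L[ℂ] H) : ℝ≥0∞ := ∑' k, ENNReal.ofReal (⟪refBasis H k, T (refBasis H k)⟫_ℂ).re

lemma ptr_star_mul_self (S : H →L[ℂ] H) : ptr (star S * S) = hsq S := by
  refine tsum_congr fun k => ?_
  rw [inner_star_mul_self, Complex.ofReal_re, ofReal_norm_sq]

lemma ptr_mul_star_self (S : H →L[ℂ] H) : ptr (S * star S) = hsq S := by
  have := ptr_star_mul_self (star S)
  rwa [star_star, hsq_star] at this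

lemma star_sqrt (T : H →L[ℂ] H) : star (CFC.sqrt T) = CFC.sqrt T :=
  (IsSelfAdjoint.of_nonneg (CFC.sqrt_nonneg T)).star_eq

lemma star_sqrt_mul_sqrt {T : H →L[ℂ] H} (hT : 0 ≤ T) : star (CFC.sqrt T) * CFC.sqrt T = T := by
  rw [star_sqrt, CFC.sqrt_mul_sqrt_self T]

lemma hsq_sqrt {T : H →L[ℂ] H} (hT : 0 ≤ T) : hsq (CFC.sqrt T) = ptr T := by
  rw [← ptr_star_mul_self, star_sqrt_mul_sqrt hT]

lemma re_inner_nonneg {T : H →L[ℂ] H} (hT : 0 ≤ T) (x : H) : 0 ≤ (⟪x, T x⟫_ℂ).re :=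
  ((ContinuousLinearMap.nonneg_iff_isPositive T).1 hT).re_inner_nonneg_right x

lemma ptr_add {S T : H →L[ℂ] H} (hS : 0 ≤ S) (hT : 0 ≤ T) : ptr (S + T) = ptr S + ptr T := by
  rw [ptr, ptr, ptr, ← ENNReal.tsum_add]
  refine tsum_congr fun k => ?_
  rw [add_apply, inner_add_right, Complex.add_re,
    ENNReal.ofReal_add (re_inner_nonneg hS _) (re_inner_nonneg hT _)]

lemma ptr_eq_zero_iff {T : H →L[ℂ] H} (hT : 0 ≤ T) : ptr T = 0 ↔ T = 0 := by
  constructor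
  · intro h
    rw [← hsq_sqrt hT] at h
    rw [← star_sqrt_mul_sqrt hT, eq_zero_of_hsq_eq_zero h, mul_zero]
  · rintro rfl
    simp [ptr]

lemma ptr_smul {c : ℝ} (hc : 0 ≤ c) (T : H →L[ℂ] H) :
    ptr ((c : ℂ) • T) = ENNReal.ofReal c * ptr T := by
  rw [ptr, ptr, ← ENNReal.tsum_mul_left]
  refine tsum_congr fun k => ?_
  rw [smul_apply, inner_smul_right, Complex.re_ofReal_mul, ENNReal.ofReal_mul hc]

lemma ptr_eq_tsum_of_hasSum {ι : Type*} {f : ι → H →L[ℂ] H} {T : H →L[ℂ] H}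
    (hf : ∀ i, 0 ≤ f i) (h : HasSum f T) : ptr T = ∑' i, ptr (f i) := by
  simp only [ptr]
  rw [ENNReal.tsum_comm]
  refine tsum_congr fun k => (tsum_ofReal_of_hasSum (fun i => re_inner_nonneg (hf i) _) ?_).symm
  set x := refBasis H k
  have := h.mapL (Complex.reCLM ∘L (((innerSL ℂ x) ∘L
    (ContinuousLinearMap.apply ℂ H x)).restrictScalars ℝ))
  exact this

lemma hasTrace_of_ptr_ne_top {T : H →L[ℂ] H} (hT : 0 ≤ T) (h : ptr T ≠ ∞) :
    HasTrace T ((ptr T).toReal : ℂ) := by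
  intro w b
  rw [← hsq_sqrt hT] at h ⊢
  rw [← tsum_enorm_sq_eq_hsq b] at h ⊢
  have h1 : (fun k => ⟪b k, T (b k)⟫_ℂ) = fun k => (((‖CFC.sqrt T (b k)‖ₑ ^ 2).toReal : ℝ) : ℂ) := by
    funext k
    conv_lhs => rw [← star_sqrt_mul_sqrt hT]
    rw [inner_star_mul_self]
    simp
  rw [h1, ENNReal.tsum_toReal_eq (fun k => by simp)]
  exact Complex.hasSum_ofReal.2 (ENNReal.summable_toReal h).hasSum

lemma ptr_eq_of_hasTrace {T : H →L[ℂ] H} (hT : 0 ≤ T) {t : ℂ} (h : HasTrace T t) :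
    ptr T = ENNReal.ofReal t.re :=
  tsum_ofReal_of_hasSum (fun _ => re_inner_nonneg hT _) (Complex.hasSum_re (h _ (refBasis H)))

lemma isTraceClass_iff_ptr_abs (T : H →L[ℂ] H) : IsTraceClass T ↔ ptr (CFC.abs T) ≠ ∞ := by
  constructor
  · rintro ⟨t, ht⟩
    rw [ptr_eq_of_hasTrace (CFC.abs_nonneg T) ht]
    exact ENNReal.ofReal_ne_top
  · exact fun h => ⟨_, hasTrace_of_ptr_ne_top (CFC.abs_nonneg T) h⟩

lemma isTraceClass_iff_ptr {T : H →L[ℂ] H} (hT : 0 ≤ T) : IsTraceClass T ↔ ptr T ≠ ∞ := by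
  rw [isTraceClass_iff_ptr_abs, CFC.abs_of_nonneg T]

lemma isState_iff (ρ : H →L[ℂ] H) : IsState ρ ↔ 0 ≤ ρ ∧ ptr ρ = 1 := by
  constructor
  · rintro ⟨h1, -, h3⟩
    have h1 := (ContinuousLinearMap.nonneg_iff_isPositive ρ).2 h1
    exact ⟨h1, by rw [ptr_eq_of_hasTrace h1 h3]; simp⟩
  · rintro ⟨h1, h2⟩
    have h3 := hasTrace_of_ptr_ne_top h1 (by simp [h2])
    rw [h2] at h3
    exact ⟨(ContinuousLinearMap.nonneg_iff_isPositive ρ).1 h1,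
      (isTraceClass_iff_ptr h1).2 (by simp [h2]), by simpa using h3⟩

/-- Douglas factorization. -/
lemma exists_eq_mul_of_norm_le {S T : H →L[ℂ] H} (h : ∀ x, ‖T x‖ ≤ ‖S x‖) :
    ∃ C : H →L[ℂ] H, T = C * S := by
  set K := (LinearMap.range (S : H →ₗ[ℂ] H)).topologicalClosure with hK
  have hS : ∀ x, S x ∈ K := fun x => Submodule.le_topologicalClosure _ ⟨x, rfl⟩
  let e : H →ₗ[ℂ] K := (S : H →ₗ[ℂ] H).codRestrict K hS
  have hd : DenseRange e := by
    rw [DenseRange, dense_iff_closure_eq, Set.eq_univ_iff_forall]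
    rintro ⟨x, hx⟩
    rw [Topology.IsInducing.subtypeVal.closure_eq_preimage_closure_image, Set.mem_preimage]
    rw [← SetLike.mem_coe, hK, Submodule.topologicalClosure_coe] at hx
    refine closure_mono ?_ hx
    rintro _ ⟨y, rfl⟩
    exact ⟨e y, ⟨y, rfl⟩, rfl⟩
  refine ⟨((T : H →ₗ[ℂ] H).extendOfNorm e) ∘L K.orthogonalProjectionOnto, ?_⟩
  ext x
  have h1 : K.orthogonalProjectionOnto (S x) = e x :=
    Submodule.orthogonalProjectionOnto_mem_subspace_eq_self (⟨S x, hS x⟩ : K)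
  rw [mul_apply_eq, ContinuousLinearMap.comp_apply, h1,
    LinearMap.extendOfNorm_eq hd ⟨1, fun x => by simpa [e] using h x⟩]
  rfl

lemma norm_abs_apply (T : H →L[ℂ] H) (x : H) : ‖CFC.abs T x‖ = ‖T x‖ := by
  have h1 := inner_star_mul_self (CFC.abs T) x
  rw [(IsSelfAdjoint.of_nonneg (CFC.abs_nonneg T)).star_eq, CFC.abs_mul_abs, inner_star_mul_self] at h1
  have h2 : ‖T x‖ ^ 2 = ‖CFC.abs T x‖ ^ 2 := by exact_mod_cast h1
  exact ((pow_left_inj₀ (norm_nonneg _) (norm_nonneg _) two_ne_zero).1 h2).symm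

/-- Polar decomposition `T = C |T|`, with `|T|` split into two equal square roots. Products of two
Hilbert-Schmidt operators are easier to add and multiply than absolute values. -/
lemma IsTraceClass.exists_factorization {T : H →L[ℂ] H} (hT : IsTraceClass T) :
    ∃ R S : H →L[ℂ] H, hsq R ≠ ∞ ∧ hsq S ≠ ∞ ∧ T = star R * S := by
  rw [isTraceClass_iff_ptr_abs, ← hsq_sqrt (CFC.abs_nonneg T)] at hT
  obtain ⟨C, hC⟩ := exists_eq_mul_of_norm_le (fun x => (norm_abs_apply T x).ge)
  refine ⟨CFC.sqrt (CFC.abs T) * star C, CFC.sqrt (CFC.abs T), hsq_mul_ne_top' hT _, hT, ?_⟩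
  rw [star_mul, star_star, mul_assoc, star_sqrt_mul_sqrt (CFC.abs_nonneg T), ← hC]

lemma ofReal_re_inner_star_mul_le (R S : H →L[ℂ] H) (x : H) :
    ENNReal.ofReal (⟪x, (star R * S) x⟫_ℂ).re ≤ ‖R x‖ₑ ^ 2 + ‖S x‖ₑ ^ 2 := by
  rw [← ofReal_norm_sq, ← ofReal_norm_sq, ← ENNReal.ofReal_add (by positivity) (by positivity)]
  refine ENNReal.ofReal_le_ofReal ?_
  rw [mul_apply_eq, inner_star_right]
  have h1 := (Complex.re_le_norm _).trans (norm_inner_le_norm (𝕜 := ℂ) (R x) (S x))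
  nlinarith [sq_nonneg (‖R x‖ - ‖S x‖), sq_nonneg (‖R x‖), sq_nonneg ‖S x‖]

/-- Writing the absolute value of the sum as `C` times the sum reduces its diagonal entries to those
of two products, each bounded by `2ab ≤ a² + b²`; no triangle inequality for the trace norm is
needed. -/
lemma isTraceClass_star_mul_add {R S R' S' : H →L[ℂ] H} (hR : hsq R ≠ ∞) (hS : hsq S ≠ ∞)
    (hR' : hsq R' ≠ ∞) (hS' : hsq S' ≠ ∞) : IsTraceClass (star R * S + star R' * S') := by
  rw [isTraceClass_iff_ptr_abs]
  obtain ⟨C, hC⟩ := exists_eq_mul_of_norm_le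
    (fun x => (norm_abs_apply (star R * S + star R' * S') x).le)
  rw [mul_add, ← mul_assoc, ← mul_assoc, ← star_star C, ← star_mul, ← star_mul] at hC
  refine ne_top_of_le_ne_top (b := (hsq (R * star C) + hsq S) + (hsq (R' * star C) + hsq S')) ?_ ?_
  · simp only [ENNReal.add_ne_top]
    exact ⟨⟨hsq_mul_ne_top' hR _, hS⟩, hsq_mul_ne_top' hR' _, hS'⟩
  · rw [hC]
    simp only [ptr, hsq]
    simp only [← ENNReal.tsum_add]
    refine ENNReal.tsum_le_tsum fun k => ?_
    rw [add_apply, inner_add_right, Complex.add_re]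
    exact ENNReal.ofReal_add_le.trans
      (add_le_add (ofReal_re_inner_star_mul_le _ _ _) (ofReal_re_inner_star_mul_le _ _ _))

lemma isTraceClass_star_mul {R S : H →L[ℂ] H} (hR : hsq R ≠ ∞) (hS : hsq S ≠ ∞) :
    IsTraceClass (star R * S) := by
  simpa using isTraceClass_star_mul_add hR hS (R' := 0) (S' := 0) (by simp [hsq_zero])
    (by simp [hsq_zero])

namespace IsTraceClass

variable {X Y : H →L[ℂ] H}

lemma add (hX : IsTraceClass X) (hY : IsTraceClass Y) : IsTraceClass (X + Y) := by
  obtain ⟨R, S, hR, hS, rfl⟩ := hX.exists_factorization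
  obtain ⟨R', S', hR', hS', rfl⟩ := hY.exists_factorization
  exact isTraceClass_star_mul_add hR hS hR' hS'

lemma mul_left (hX : IsTraceClass X) (T : H →L[ℂ] H) : IsTraceClass (T * X) := by
  obtain ⟨R, S, hR, hS, rfl⟩ := hX.exists_factorization
  rw [← mul_assoc, ← star_star T, ← star_mul]
  exact isTraceClass_star_mul (hsq_mul_ne_top' hR _) hS

lemma mul_right (hX : IsTraceClass X) (T : H →L[ℂ] H) : IsTraceClass (X * T) := by
  obtain ⟨R, S, hR, hS, rfl⟩ := hX.exists_factorization
  rw [mul_assoc]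
  exact isTraceClass_star_mul hR (hsq_mul_ne_top' hS _)

protected lemma star (hX : IsTraceClass X) : IsTraceClass (star X) := by
  obtain ⟨R, S, hR, hS, rfl⟩ := hX.exists_factorization
  rw [star_mul, star_star]
  exact isTraceClass_star_mul hS hR

lemma smul (hX : IsTraceClass X) (c : ℂ) : IsTraceClass (c • X) := by
  simpa using hX.mul_left (c • 1)

lemma neg (hX : IsTraceClass X) : IsTraceClass (-X) := by
  simpa using hX.smul (-1)

end IsTraceClass

lemma IsTraceClass.abs {X : H →L[ℂ] H} (hX : IsTraceClass X) : IsTraceClass (CFC.abs X) := by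
  rwa [isTraceClass_iff_ptr_abs, CFC.cfcAbs_cfcAbs, ← isTraceClass_iff_ptr_abs]

lemma IsTraceClass.posPart {X : H →L[ℂ] H} (hX : IsTraceClass X) (hs : IsSelfAdjoint X) :
    IsTraceClass X⁺ := by
  have h : X⁺ = (2⁻¹ : ℂ) • (CFC.abs X + X) := by
    rw [CFC.abs_add_self X, ← Nat.cast_smul_eq_nsmul ℂ, smul_smul]
    norm_num
  rw [h]
  exact (hX.abs.add hX).smul _

lemma IsTraceClass.negPart {X : H →L[ℂ] H} (hX : IsTraceClass X) (hs : IsSelfAdjoint X) :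
    IsTraceClass X⁻ := by
  rw [← CFC.posPart_neg]
  exact hX.neg.posPart hs.neg

end HilbertSchmidt

/-! ### Orthogonal projections, supports, positive and negative parts. -/

section Projections

variable {H : Type*} [NormedAddCommGroup H] [InnerProductSpace ℂ H] [CompleteSpace H]

lemma star_proj (K : Submodule ℂ H) : star (proj K) = proj K :=
  isSelfAdjoint_starProjection _

lemma proj_mul_self (K : Submodule ℂ H) : proj K * proj K = proj K :=
  Submodule.isIdempotentElem_starProjection _

lemma proj_mem {K : Submodule ℂ H} (hK : IsClosed (K : Set H)) (x : H) : proj K x ∈ K :=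
  hK.submodule_topologicalClosure_eq.le (Submodule.starProjection_apply_mem _ x)

lemma proj_apply_of_mem {K : Submodule ℂ H} {x : H} (hx : x ∈ K) : proj K x = x :=
  Submodule.starProjection_eq_self_iff.2 (K.le_topologicalClosure hx)

lemma proj_eq_self_iff {K : Submodule ℂ H} (hK : IsClosed (K : Set H)) {x : H} :
    proj K x = x ↔ x ∈ K :=
  ⟨fun h => h ▸ proj_mem hK x, proj_apply_of_mem⟩

lemma proj_eq_zero_iff {K : Submodule ℂ H} {x : H} : proj K x = 0 ↔ x ∈ Kᗮ := by
  rw [proj, Submodule.starProjection_apply_eq_zero_iff, Submodule.orthogonal_closure]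

lemma proj_mul_proj_of_le {K L : Submodule ℂ H} (hL : IsClosed (K : Set H)) (h : K ≤ L) :
    proj L * proj K = proj K := by
  ext x
  exact proj_apply_of_mem (h (proj_mem hL x))

lemma proj_mul_proj_of_le' {K L : Submodule ℂ H} (hL : IsClosed (K : Set H)) (h : K ≤ L) :
    proj K * proj L = proj K := by
  have := congrArg star (proj_mul_proj_of_le hL h)
  rwa [star_mul, star_proj, star_proj] at this

lemma proj_mul_proj_of_isOrtho {K L : Submodule ℂ H} (hL : IsClosed (L : Set H)) (h : K ⟂ L) :
    proj K * proj L = 0 := by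
  ext x
  exact proj_eq_zero_iff.2 (h.ge (proj_mem hL x))

lemma proj_mul_eq_iff {K : Submodule ℂ H} (hK : IsClosed (K : Set H)) (T : H →L[ℂ] H) :
    proj K * T = T ↔ ∀ x, T x ∈ K := by
  rw [ContinuousLinearMap.ext_iff]
  exact forall_congr' fun x => proj_eq_self_iff hK

lemma eq_zero_of_star_mul_self {T : H →L[ℂ] H} (h : star T * T = 0) : T = 0 :=
  CStarRing.star_mul_self_eq_zero_iff T |>.1 h

/-- A positive operator whose compression vanishes is itself annihilated. -/
lemma mul_eq_zero_of_conj_eq_zero {T B : H →L[ℂ] H} (hT : 0 ≤ T) (h : star B * T * B = 0) :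
    T * B = 0 := by
  rw [← star_sqrt_mul_sqrt hT] at h ⊢
  have : CFC.sqrt T * B = 0 := eq_zero_of_star_mul_self (by simpa [mul_assoc] using h)
  rw [mul_assoc, this, mul_zero]

lemma supp_isClosed (T : H →L[ℂ] H) : IsClosed (supp T : Set H) :=
  Submodule.isClosed_topologicalClosure _

lemma mem_supp (T : H →L[ℂ] H) (x : H) : T x ∈ supp T :=
  Submodule.le_topologicalClosure _ ⟨x, rfl⟩

lemma supp_le_iff {T : H →L[ℂ] H} {K : Submodule ℂ H} (hK : IsClosed (K : Set H)) :
    supp T ≤ K ↔ ∀ x, T x ∈ K := by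
  refine ⟨fun h x => h (mem_supp T x), fun h => Submodule.topologicalClosure_minimal _ ?_ hK⟩
  rintro _ ⟨x, rfl⟩
  exact h x

lemma supp_le_iff_proj_mul {T : H →L[ℂ] H} {K : Submodule ℂ H} (hK : IsClosed (K : Set H)) :
    supp T ≤ K ↔ proj K * T = T := by
  rw [supp_le_iff hK, proj_mul_eq_iff hK]

lemma supp_eq_bot_iff {T : H →L[ℂ] H} : supp T = ⊥ ↔ T = 0 := by
  rw [← le_bot_iff, supp_le_iff (by simp)]
  simp [ContinuousLinearMap.ext_iff]

lemma mem_supp_orthogonal_iff {T : H →L[ℂ] H} (hT : IsSelfAdjoint T) {x : H} :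
    x ∈ (supp T)ᗮ ↔ T x = 0 := by
  rw [supp, Submodule.orthogonal_closure, Submodule.mem_orthogonal]
  constructor
  · intro h
    have := h (T (T x)) ⟨T x, rfl⟩
    rwa [← inner_star_right, hT.star_eq, inner_self_eq_zero] at this
  · rintro h _ ⟨y, rfl⟩
    change ⟪T y, x⟫_ℂ = 0
    rw [← inner_star_right, hT.star_eq, h, inner_zero_right]

lemma mem_of_forall_orthogonal {K : Submodule ℂ H} (hK : IsClosed (K : Set H)) {x : H}
    (h : ∀ y ∈ Kᗮ, ⟪y, x⟫_ℂ = 0) : x ∈ K := by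
  have h2 : x ∈ Kᗮᗮ := (Submodule.mem_orthogonal _ _).2 h
  rwa [Submodule.orthogonal_orthogonal_eq_closure, hK.submodule_topologicalClosure_eq] at h2

lemma supp_le_iff_orthogonal {T : H →L[ℂ] H} (hT : IsSelfAdjoint T) {K : Submodule ℂ H}
    (hK : IsClosed (K : Set H)) : supp T ≤ K ↔ ∀ x ∈ Kᗮ, T x = 0 := by
  constructor
  · exact fun h x hx => (mem_supp_orthogonal_iff hT).1 (Submodule.orthogonal_le h hx)
  · intro h x hx
    refine mem_of_forall_orthogonal hK fun y hy => ?_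
    exact Submodule.inner_left_of_mem_orthogonal hx ((mem_supp_orthogonal_iff hT).2 (h y hy))

lemma proj_supp_mul (T : H →L[ℂ] H) : proj (supp T) * T = T :=
  (supp_le_iff_proj_mul (supp_isClosed T)).1 le_rfl

/-- Pythagoras, column by column. -/
lemma hsq_eq_add (K : Submodule ℂ H) (S : H →L[ℂ] H) :
    hsq S = hsq (proj K * S) + hsq ((1 - proj K) * S) := by
  rw [hsq, hsq, hsq, ← ENNReal.tsum_add]
  refine tsum_congr fun k => ?_
  simp only [← ofReal_norm_sq]
  rw [← ENNReal.ofReal_add (by positivity) (by positivity)]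
  congr 1
  rw [Submodule.norm_sq_eq_add_norm_sq_starProjection _ K.topologicalClosure,
    Submodule.starProjection_orthogonal']
  rfl

lemma ptr_conj {T : H →L[ℂ] H} (hT : 0 ≤ T) (B : H →L[ℂ] H) :
    ptr (B * T * star B) = hsq (B * CFC.sqrt T) := by
  rw [← ptr_mul_star_self, star_mul, star_sqrt, mul_assoc B (CFC.sqrt T), ← mul_assoc (CFC.sqrt T),
    CFC.sqrt_mul_sqrt_self T, mul_assoc]

lemma ptr_eq_add (K : Submodule ℂ H) {T : H →L[ℂ] H} (hT : 0 ≤ T) :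
    ptr T = ptr (proj K * T * proj K) + ptr ((1 - proj K) * T * (1 - proj K)) := by
  have h1 := ptr_conj hT (proj K)
  have h2 := ptr_conj hT (1 - proj K)
  rw [star_proj] at h1
  rw [star_sub, star_one, star_proj] at h2
  rw [h1, h2, ← hsq_eq_add, hsq_sqrt hT]

lemma negPart_apply_of_mem_supp_posPart (X : H →L[ℂ] H) {x : H} (hx : x ∈ supp X⁺) :
    X⁻ x = 0 := by
  have : supp X⁺ ≤ LinearMap.ker ((X⁻ : H →L[ℂ] H) : H →ₗ[ℂ] H) := by
    refine (supp_le_iff (X⁻).isClosed_ker).2 fun x => ?_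
    change (X⁻ * X⁺) x = 0
    rw [CFC.negPart_mul_posPart]
    rfl
  exact this hx

/-- On the kernel of `X` the vectors `X⁺ x` and `X⁻ x` agree, while the ranges of `X⁺` and `X⁻` are
orthogonal. -/
lemma posPart_apply_eq_zero {X : H →L[ℂ] H} (hX : IsSelfAdjoint X) {x : H} (hx : X x = 0) :
    X⁺ x = 0 := by
  have h1 : X⁺ x = X⁻ x := by
    have := congrArg (fun T : H →L[ℂ] H => T x) (CFC.posPart_sub_negPart X)
    rw [hx] at this
    exact sub_eq_zero.1 this
  rw [← inner_self_eq_zero (𝕜 := ℂ)]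
  nth_rw 1 [h1]
  rw [← (IsSelfAdjoint.of_nonneg (CFC.negPart_nonneg X)).star_eq, inner_star_left, ← mul_apply_eq,
    CFC.negPart_mul_posPart]
  simp

lemma negPart_apply_eq_zero {X : H →L[ℂ] H} (hX : IsSelfAdjoint X) {x : H} (hx : X x = 0) :
    X⁻ x = 0 := by
  rw [← CFC.posPart_neg]
  exact posPart_apply_eq_zero hX.neg (by simpa using hx)

end Projections

/-! ### The Kraus map on trace-class operators and conservation of the trace. -/

section Kraus

variable {H : Type*} [NormedAddCommGroup H] [InnerProductSpace ℂ H] [CompleteSpace H]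
  {ι : Type*} (A : ι → H →L[ℂ] H)

/-- The stochasticity condition `∑ A* A = Id` of a family of Kraus operators. -/
def IsStochastic : Prop := ∀ x, HasSum (fun p => ‖A p x‖ ^ 2) (‖x‖ ^ 2)

/-- The map `X ↦ ∑ A X A*`. -/
def krausMap (X : H →L[ℂ] H) : H →L[ℂ] H := ∑' p, A p * X * star (A p)

variable {A}

lemma tsum_hsq_mul (hA : IsStochastic A) (S : H →L[ℂ] H) : ∑' p, hsq (A p * S) = hsq S := by
  simp only [hsq]
  rw [ENNReal.tsum_comm]
  refine tsum_congr fun k => ?_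
  simp only [← ofReal_norm_sq]
  exact tsum_ofReal_of_hasSum (fun _ => by positivity) (hA _)

lemma summable_norm_mul_sq (hA : IsStochastic A) {S : H →L[ℂ] H} (hS : hsq S ≠ ∞) :
    Summable fun p => ‖A p * S‖ ^ 2 := by
  have h : ∑' p, ENNReal.ofReal (‖A p * S‖ ^ 2) ≠ ∞ := by
    refine ne_top_of_le_ne_top hS ?_
    rw [← tsum_hsq_mul hA]
    exact ENNReal.tsum_le_tsum fun p => norm_sq_le_hsq _
  refine (ENNReal.summable_toReal h).congr fun p => ?_
  rw [ENNReal.toReal_ofReal (by positivity)]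

/-- Splitting `X = R* S` gives terms `(A R*)(A S*)*`, whose norms are dominated by the squares of
Hilbert-Schmidt norms, and these sum to a finite total by stochasticity. -/
lemma summable_kraus (hA : IsStochastic A) {X : H →L[ℂ] H} (hX : IsTraceClass X) :
    Summable fun p => A p * X * star (A p) := by
  obtain ⟨R, S, hR, hS, rfl⟩ := hX.exists_factorization
  refine Summable.of_norm_bounded ((summable_norm_mul_sq hA (S := star R) (by rwa [hsq_star])).add
    (summable_norm_mul_sq hA (S := star S) (by rwa [hsq_star]))) fun p => ?_
  have h1 : A p * (star R * S) * star (A p) = (A p * star R) * star (A p * star S) := by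
    simp [mul_assoc]
  rw [h1]
  refine (norm_mul_le _ _).trans ?_
  rw [norm_star]
  nlinarith [sq_nonneg (‖A p * star R‖ - ‖A p * star S‖), sq_nonneg ‖A p * star R‖,
    sq_nonneg ‖A p * star S‖]

lemma hasSum_krausMap (hA : IsStochastic A) {X : H →L[ℂ] H} (hX : IsTraceClass X) :
    HasSum (fun p => A p * X * star (A p)) (krausMap A X) :=
  (summable_kraus hA hX).hasSum

lemma krausMap_add (hA : IsStochastic A) {X Y : H →L[ℂ] H} (hX : IsTraceClass X)
    (hY : IsTraceClass Y) : krausMap A (X + Y) = krausMap A X + krausMap A Y := by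
  rw [krausMap, krausMap, krausMap, ← (summable_kraus hA hX).tsum_add (summable_kraus hA hY)]
  simp only [mul_add, add_mul]

lemma krausMap_smul (c : ℂ) (X : H →L[ℂ] H) : krausMap A (c • X) = c • krausMap A X := by
  rw [krausMap, krausMap, ← tsum_const_smul'']
  simp only [mul_smul_comm, smul_mul_assoc]

lemma krausMap_star (X : H →L[ℂ] H) : krausMap A (star X) = star (krausMap A X) := by
  rw [krausMap, krausMap, tsum_star]
  simp only [star_mul, star_star, mul_assoc]

lemma hasSum_inner_krausMap (hA : IsStochastic A) {X : H →L[ℂ] H} (hX : IsTraceClass X) (x y : H) :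
    HasSum (fun p => ⟪star (A p) x, X (star (A p) y)⟫_ℂ) ⟪x, krausMap A X y⟫_ℂ := by
  have h : (fun p => ⟪star (A p) x, X (star (A p) y)⟫_ℂ) =
      fun p => ⟪x, (A p * X * star (A p)) y⟫_ℂ := by
    funext p
    rw [inner_star_left]
    rfl
  rw [h]
  exact (hasSum_krausMap hA hX).mapL ((innerSL ℂ x) ∘L (ContinuousLinearMap.apply ℂ H y))

lemma krausMap_nonneg {X : H →L[ℂ] H} (hX : 0 ≤ X) : 0 ≤ krausMap A X :=
  tsum_nonneg fun _ => star_right_conjugate_nonneg hX _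

lemma ptr_krausMap (hA : IsStochastic A) {X : H →L[ℂ] H} (hX : 0 ≤ X) (hX' : IsTraceClass X)
    (B : H →L[ℂ] H) :
    ptr (B * krausMap A X * star B) = ∑' p, hsq (B * A p * CFC.sqrt X) := by
  have h := ((hasSum_krausMap hA hX').mul_left B).mul_right (star B)
  rw [ptr_eq_tsum_of_hasSum (fun _ => star_right_conjugate_nonneg
    (star_right_conjugate_nonneg hX _) _) h]
  refine tsum_congr fun p => ?_
  rw [← ptr_conj hX, star_mul]
  simp only [mul_assoc]

lemma ptr_krausMap_self (hA : IsStochastic A) {X : H →L[ℂ] H} (hX : 0 ≤ X) (hX' : IsTraceClass X) :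
    ptr (krausMap A X) = ptr X := by
  have := ptr_krausMap hA hX hX' 1
  simpa [tsum_hsq_mul hA, hsq_sqrt hX] using this

end Kraus

/-! ### Stable subspaces, the commutant, and fixed operators on minimal stable subspaces. -/

section Kraus

variable {H : Type*} [NormedAddCommGroup H] [InnerProductSpace ℂ H] [CompleteSpace H]
  {ι : Type*} (A : ι → H →L[ℂ] H)

/-- A closed subspace that is mapped into itself by all Kraus operators. -/
def IsStable (K : Submodule ℂ H) : Prop :=
  IsClosed (K : Set H) ∧ ∀ p, ∀ x ∈ K, A p x ∈ K

/-- A minimal nonzero stable subspace. -/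
def IsMinimalStable (K : Submodule ℂ H) : Prop :=
  IsStable A K ∧ K ≠ ⊥ ∧ ∀ K', IsStable A K' → K' ≤ K → K' ≠ ⊥ → K' = K

/-- A trace-class operator that is fixed by the Kraus map. -/
def IsFixed (X : H →L[ℂ] H) : Prop := IsTraceClass X ∧ krausMap A X = X

/-- A state that is fixed by the Kraus map. -/
def IsFixedState (ρ : H →L[ℂ] H) : Prop := IsState ρ ∧ krausMap A ρ = ρ

/-- The closed span of the supports of the fixed states. -/
def fixedSupport : Submodule ℂ H :=
  (⨆ (ρ : H →L[ℂ] H) (_ : IsFixedState A ρ), supp ρ).topologicalClosure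

/-- The operators that commute with the projection onto `fixedSupport A`, with the restrictions of
the Kraus operators to this subspace, and with their adjoints. -/
def fixedCommutant : StarSubalgebra ℂ (H →L[ℂ] H) :=
  StarSubalgebra.centralizer ℂ
    (insert (proj (fixedSupport A)) (Set.range fun p => A p * proj (fixedSupport A)))

variable {A}

lemma IsFixedState.isFixed {ρ : H →L[ℂ] H} (h : IsFixedState A ρ) : IsFixed A ρ := ⟨h.1.2.1, h.2⟩

lemma IsFixedState.nonneg {ρ : H →L[ℂ] H} (h : IsFixedState A ρ) : 0 ≤ ρ :=
  ((isState_iff ρ).1 h.1).1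

lemma IsFixedState.ptr_eq {ρ : H →L[ℂ] H} (h : IsFixedState A ρ) : ptr ρ = 1 :=
  ((isState_iff ρ).1 h.1).2

lemma IsFixedState.ne_zero {ρ : H →L[ℂ] H} (h : IsFixedState A ρ) : ρ ≠ 0 := by
  intro h0
  have := h.ptr_eq
  rw [(ptr_eq_zero_iff h.nonneg).2 h0] at this
  exact zero_ne_one this

lemma IsFixed.add (hA : IsStochastic A) {X Y : H →L[ℂ] H} (hX : IsFixed A X) (hY : IsFixed A Y) :
    IsFixed A (X + Y) :=
  ⟨hX.1.add hY.1, by rw [krausMap_add hA hX.1 hY.1, hX.2, hY.2]⟩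

lemma IsFixed.smul {X : H →L[ℂ] H} (hX : IsFixed A X) (c : ℂ) : IsFixed A (c • X) :=
  ⟨hX.1.smul c, by rw [krausMap_smul, hX.2]⟩

lemma IsFixed.neg {X : H →L[ℂ] H} (hX : IsFixed A X) : IsFixed A (-X) := by
  simpa using hX.smul (-1)

lemma IsFixed.sub (hA : IsStochastic A) {X Y : H →L[ℂ] H} (hX : IsFixed A X) (hY : IsFixed A Y) :
    IsFixed A (X - Y) := by
  simpa [sub_eq_add_neg] using hX.add hA hY.neg

protected lemma IsFixed.star {X : H →L[ℂ] H} (hX : IsFixed A X) : IsFixed A (star X) :=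
  ⟨hX.1.star, by rw [krausMap_star, hX.2]⟩

lemma isFixedState_normalize {X : H →L[ℂ] H} (h : IsFixed A X) (h0 : 0 ≤ X) (hne : X ≠ 0) :
    0 < (ptr X).toReal ∧ IsFixedState A ((((ptr X).toReal⁻¹ : ℝ) : ℂ) • X) := by
  have h1 : ptr X ≠ ∞ := (isTraceClass_iff_ptr h0).1 h.1
  have h2 : 0 < (ptr X).toReal := ENNReal.toReal_pos (by rwa [ne_eq, ptr_eq_zero_iff h0]) h1
  refine ⟨h2, (isState_iff _).2 ⟨?_, ?_⟩, (h.smul _).2⟩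
  · rw [ContinuousLinearMap.nonneg_iff_isPositive] at h0 ⊢
    exact h0.smul_of_nonneg (by exact_mod_cast (inv_pos.2 h2).le)
  · rw [ptr_smul (inv_pos.2 h2).le, ENNReal.ofReal_inv_of_pos h2, ENNReal.ofReal_toReal h1,
      ENNReal.inv_mul_cancel (by rwa [ne_eq, ptr_eq_zero_iff h0]) h1]

lemma supp_smul {c : ℂ} (hc : c ≠ 0) (X : H →L[ℂ] H) : supp (c • X) = supp X := by
  have h : ∀ (c : ℂ) (X : H →L[ℂ] H), supp (c • X) ≤ supp X := fun c X =>
    (supp_le_iff (supp_isClosed X)).2 fun x => Submodule.smul_mem _ c (mem_supp X x)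
  refine le_antisymm (h c X) ?_
  simpa [smul_smul, inv_mul_cancel₀ hc] using h c⁻¹ (c • X)

lemma isStable_supp (hA : IsStochastic A) {X : H →L[ℂ] H} (hX : IsFixed A X) (h0 : 0 ≤ X) :
    IsStable A (supp X) := by
  have hsa : IsSelfAdjoint X := IsSelfAdjoint.of_nonneg h0
  -- The kernel of `X` is invariant under each `(A p)*`: `⟪x, X x⟫ = 0` is a sum of nonnegative
  -- terms `⟪(A p)* x, X (A p)* x⟫`, so each vanishes.
  have key : ∀ p x, X x = 0 → X (star (A p) x) = 0 := by
    intro p x hx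
    have h1 := Complex.hasSum_re (hasSum_inner_krausMap hA hX.1 x x)
    rw [hX.2, hx, inner_zero_right, Complex.zero_re, hasSum_zero_iff_of_nonneg
      (fun p => re_inner_nonneg h0 _)] at h1
    have h2 := congrFun h1 p
    simp only [Pi.zero_apply] at h2
    rw [← star_sqrt_mul_sqrt h0] at h2
    rw [inner_star_mul_self, Complex.ofReal_re, sq_eq_zero_iff, norm_eq_zero] at h2
    rw [← star_sqrt_mul_sqrt h0, mul_apply_eq, h2, map_zero]
  refine ⟨supp_isClosed X, fun p x hx => mem_of_forall_orthogonal (supp_isClosed X) fun y hy => ?_⟩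
  rw [← inner_star_left]
  refine Submodule.inner_left_of_mem_orthogonal hx ?_
  rw [mem_supp_orthogonal_iff hsa] at hy ⊢
  exact key p y hy

/-- The complement of a stable subspace is invariant on the support of a fixed state. -/
lemma proj_mul_kraus_mul_fixed (hA : IsStochastic A) {E : Submodule ℂ H} (hE : IsStable A E)
    {X : H →L[ℂ] H} (hX : IsFixed A X) (h0 : 0 ≤ X) (p : ι) :
    proj E * A p * (1 - proj E) * X = 0 := by
  set P := proj E with hP
  set s := CFC.sqrt X with hs
  have hNA : ∀ p, (1 - P) * A p = (1 - P) * A p * (1 - P) := by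
    intro p
    have : (1 - P) * A p * P = 0 := by
      ext x
      have := proj_apply_of_mem (hE.2 p _ (proj_mem hE.1 x))
      simpa [mul_apply_eq, sub_eq_zero] using this.symm
    rw [mul_sub _ 1 P, mul_one, this, sub_zero]
  have hfin : hsq ((1 - P) * s) ≠ ∞ :=
    hsq_mul_ne_top _ (by rw [hsq_sqrt h0]; exact (isTraceClass_iff_ptr h0).1 hX.1)
  -- The mass of `X` outside `E`, computed after one step of the map: as `E` is stable, it comes
  -- only from mass already outside.
  have h1 : hsq ((1 - P) * s) = ∑' p, hsq ((1 - P) * (A p * ((1 - P) * s))) := by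
    have := ptr_krausMap hA h0 hX.1 (1 - P)
    rw [hX.2, ptr_conj h0] at this
    rw [this]
    refine tsum_congr fun p => ?_
    rw [hNA p]
    simp only [mul_assoc, hs]
  -- Stochasticity splits the same mass into what enters `E` and what stays outside. The latter is
  -- already everything, and `hfin` allows the cancellation.
  have h2 : hsq ((1 - P) * s) = ∑' p, hsq (P * (A p * ((1 - P) * s))) + hsq ((1 - P) * s) := by
    conv_lhs => rw [← tsum_hsq_mul hA]
    conv_rhs => rw [h1]
    rw [← ENNReal.tsum_add]
    exact tsum_congr fun p => hsq_eq_add E _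
  have h3 : ∑' p, hsq (P * (A p * ((1 - P) * s))) = 0 := by
    exact (ENNReal.add_left_inj hfin).1 (h2.symm.trans (zero_add _).symm)
  have h4 := eq_zero_of_hsq_eq_zero (ENNReal.tsum_eq_zero.1 h3 p)
  rw [← star_sqrt_mul_sqrt h0, star_sqrt, ← hs]
  simp only [← mul_assoc] at h4 ⊢
  rw [h4, zero_mul]

lemma fixedSupport_isClosed : IsClosed (fixedSupport A : Set H) :=
  Submodule.isClosed_topologicalClosure _

lemma IsFixedState.supp_le {ρ : H →L[ℂ] H} (h : IsFixedState A ρ) : supp ρ ≤ fixedSupport A :=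
  (le_iSup₂_of_le (f := fun ρ (_ : IsFixedState A ρ) => supp ρ) ρ h le_rfl).trans
    (Submodule.le_topologicalClosure _)

lemma fixedSupport_le {K : Submodule ℂ H} (hK : IsClosed (K : Set H))
    (h : ∀ ρ, IsFixedState A ρ → supp ρ ≤ K) : fixedSupport A ≤ K :=
  Submodule.topologicalClosure_minimal _ (iSup₂_le h) hK

lemma proj_mul_kraus_mul_proj (hA : IsStochastic A) {E : Submodule ℂ H} (hE : IsStable A E) (p : ι) :
    proj E * A p * (1 - proj E) * proj (fixedSupport A) = 0 := by
  have h : fixedSupport A ≤ LinearMap.ker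
      ((proj E * A p * (1 - proj E) : H →L[ℂ] H) : H →ₗ[ℂ] H) := by
    refine fixedSupport_le (ContinuousLinearMap.isClosed_ker _) fun ρ hρ => ?_
    refine (supp_le_iff (ContinuousLinearMap.isClosed_ker _)).2 fun x => ?_
    have := proj_mul_kraus_mul_fixed hA hE hρ.isFixed hρ.nonneg p
    exact congrArg (fun T : H →L[ℂ] H => T x) this
  ext x
  exact h (proj_mem fixedSupport_isClosed x)

lemma mem_fixedCommutant_iff {T : H →L[ℂ] H} : T ∈ fixedCommutant A ↔
    (proj (fixedSupport A) * T = T * proj (fixedSupport A) ∧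
      ∀ p, A p * proj (fixedSupport A) * T = T * (A p * proj (fixedSupport A))) ∧
    (proj (fixedSupport A) * star T = star T * proj (fixedSupport A) ∧
      ∀ p, A p * proj (fixedSupport A) * star T = star T * (A p * proj (fixedSupport A))) := by
  have hstar : ∀ g : H →L[ℂ] H, star g * T = T * star g ↔ g * star T = star T * g := fun g => by
    rw [← star_inj, star_mul, star_mul, star_star, eq_comm]
  rw [fixedCommutant, StarSubalgebra.mem_centralizer_iff]
  simp only [Set.forall_mem_insert, Set.forall_mem_range, hstar, forall_and, and_and_and_comm]

/-- Stability gives `P A P = A P`; the absence of flow into `E` gives `P A (1 - P) = 0` on `R`.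
Together they say that `P` commutes with `A` on `R`. -/
lemma proj_mem_fixedCommutant (hA : IsStochastic A) {E : Submodule ℂ H} (hE : IsStable A E)
    (hle : E ≤ fixedSupport A) : proj E ∈ fixedCommutant A := by
  rw [mem_fixedCommutant_iff, star_proj, and_self]
  have h1 := proj_mul_proj_of_le hE.1 hle
  have h2 := proj_mul_proj_of_le' hE.1 hle
  refine ⟨h1.trans h2.symm, fun p => ?_⟩
  have h3 := proj_mul_kraus_mul_proj hA hE p
  have h4 : proj E * A p * proj E = A p * proj E := by
    ext x
    exact proj_apply_of_mem (hE.2 p _ (proj_mem hE.1 x))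
  rw [mul_sub, mul_one, sub_mul, mul_assoc _ (proj E), h2, h4, sub_eq_zero] at h3
  rw [mul_assoc, h1, ← h3, mul_assoc]

lemma kraus_apply_comm {T : H →L[ℂ] H} (hT : T ∈ fixedCommutant A) (p : ι) {x : H}
    (hx : x ∈ fixedSupport A) : A p (T x) = T (A p x) := by
  have h1 := (mem_fixedCommutant_iff.1 hT).1
  have h2 := congrArg (fun S : H →L[ℂ] H => S x) (h1.2 p)
  have h3 := congrArg (fun S : H →L[ℂ] H => S x) h1.1
  simp only [mul_apply_eq] at h2 h3
  rw [h3, proj_apply_of_mem hx] at h2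
  exact h2

lemma kraus_mul_comm {T X : H →L[ℂ] H} (hT : T ∈ fixedCommutant A)
    (hX : proj (fixedSupport A) * X = X) (p : ι) : A p * (T * X) = T * (A p * X) := by
  ext x
  refine kraus_apply_comm hT p ?_
  rw [← hX]
  exact proj_mem fixedSupport_isClosed _

/-- `S` moves past `A p` on the left and `T` past `(A p)*` on the right, because `X` lives on `R`
from both sides. -/
lemma IsFixed.mul_mul (hA : IsStochastic A) {X S T : H →L[ℂ] H} (hX : IsFixed A X)
    (h1 : proj (fixedSupport A) * X = X) (h2 : X * proj (fixedSupport A) = X)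
    (hS : S ∈ fixedCommutant A) (hT : T ∈ fixedCommutant A) : IsFixed A (S * X * T) := by
  refine ⟨(hX.1.mul_left S).mul_right T, ?_⟩
  have h := ((hasSum_krausMap hA hX.1).mul_left S).mul_right T
  rw [hX.2] at h
  refine Eq.trans (tsum_congr fun p => ?_) h.tsum_eq
  have h3 : proj (fixedSupport A) * star X = star X := by
    have := congrArg star h2
    rwa [star_mul, star_proj] at this
  have h4 := congrArg star (kraus_mul_comm (star_mem hT) h3 p)
  simp only [star_mul, star_star] at h4
  calc A p * (S * X * T) * star (A p) = A p * (S * (X * T * star (A p))) := by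
        simp only [mul_assoc]
    _ = A p * (S * X) * star (A p) * T := by rw [h4]; simp only [mul_assoc]
    _ = _ := by rw [kraus_mul_comm hS h1]; simp only [mul_assoc]

lemma IsFixed.posPart (hA : IsStochastic A) {X : H →L[ℂ] H} (hX : IsFixed A X)
    (hsa : IsSelfAdjoint X) : IsFixed A X⁺ := by
  have tp := hX.1.posPart hsa
  have tn := hX.1.negPart hsa
  have pp := CFC.posPart_nonneg X
  have pn := CFC.negPart_nonneg X
  set a := krausMap A X⁺ with ha
  set b := krausMap A X⁻ with hb
  have ha0 : 0 ≤ a := krausMap_nonneg pp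
  have hb0 : 0 ≤ b := krausMap_nonneg pn
  set P := proj (supp X⁺) with hP
  have hab : a = X⁺ + b - X⁻ := by
    have h1 := krausMap_add hA hX.1 tn
    have h2 : X + X⁻ = X⁺ := by
      nth_rw 1 [← CFC.posPart_sub_negPart X]; abel
    rw [h2, hX.2] at h1
    rw [ha, h1, ← h2]; abel
  have hPp : P * X⁺ = X⁺ := proj_supp_mul _
  have hpP : X⁺ * P = X⁺ := by
    have := congrArg star hPp
    rwa [star_mul, hP, star_proj, (IsSelfAdjoint.of_nonneg pp).star_eq] at this
  have hnP : X⁻ * P = 0 := by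
    ext x
    exact negPart_apply_of_mem_supp_posPart X (proj_mem (supp_isClosed _) x)
  have hPaP : P * a * P = X⁺ + P * b * P := by
    rw [hab, mul_sub, mul_add, sub_mul, add_mul, hPp, hpP, mul_assoc P X⁻, hnP, mul_zero, sub_zero]
  have hPbP0 : 0 ≤ P * b * P := by
    have := star_right_conjugate_nonneg hb0 P
    rwa [hP, star_proj] at this
  -- The image `a` of `X⁺` has the trace of `X⁺`, but its compression to the support of `X⁺` already
  -- dominates `X⁺`. So the excess `P b P` and the part of `a` off that support both have trace
  -- zero.
  have h1 : ptr X⁺ = ptr X⁺ + (ptr (P * b * P) + ptr ((1 - P) * a * (1 - P))) := by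
    rw [← add_assoc, ← ptr_add pp hPbP0, ← hPaP, hP, ← ptr_eq_add _ ha0]
    exact (ptr_krausMap_self hA pp tp).symm
  have h2 := (ENNReal.add_right_inj ((isTraceClass_iff_ptr pp).1 tp)).1 (h1.symm.trans (add_zero _).symm)
  rw [add_eq_zero, ptr_eq_zero_iff hPbP0] at h2
  have h3 : a * (1 - P) = 0 := by
    refine mul_eq_zero_of_conj_eq_zero ha0 ?_
    have hn := star_right_conjugate_nonneg ha0 (1 - P)
    have hst : star (1 - P) = 1 - P := by rw [star_sub, star_one, hP, star_proj]
    rw [hst] at hn ⊢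
    exact (ptr_eq_zero_iff hn).1 h2.2
  have h4 : a * P = a := by
    rw [mul_sub, mul_one, sub_eq_zero] at h3
    exact h3.symm
  have h5 : P * a = a := by
    have := congrArg star h4
    rwa [star_mul, hP, star_proj, (IsSelfAdjoint.of_nonneg ha0).star_eq] at this
  refine ⟨tp, ?_⟩
  rw [h5, h4, h2.1, add_zero] at hPaP
  exact hPaP

lemma IsFixed.negPart (hA : IsStochastic A) {X : H →L[ℂ] H} (hX : IsFixed A X)
    (hsa : IsSelfAdjoint X) : IsFixed A X⁻ := by
  rw [← CFC.posPart_neg]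
  exact hX.neg.posPart hA hsa.neg

lemma IsMinimalStable.supp_eq (hA : IsStochastic A) {E : Submodule ℂ H} (hE : IsMinimalStable A E)
    {X : H →L[ℂ] H} (hX : IsFixed A X) (h0 : 0 ≤ X) (hle : supp X ≤ E) (hne : X ≠ 0) :
    supp X = E :=
  hE.2.2 _ (isStable_supp hA hX h0) hle (by rwa [ne_eq, supp_eq_bot_iff])

lemma IsMinimalStable.fixedState_unique (hA : IsStochastic A) {E : Submodule ℂ H}
    (hE : IsMinimalStable A E) {ρ σ : H →L[ℂ] H} (hρ : IsFixedState A ρ) (hσ : IsFixedState A σ)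
    (hρE : supp ρ ≤ E) (hσE : supp σ ≤ E) : ρ = σ := by
  set X := ρ - σ with hX
  have hρs : IsSelfAdjoint ρ := .of_nonneg hρ.nonneg
  have hσs : IsSelfAdjoint σ := .of_nonneg hσ.nonneg
  have hXs : IsSelfAdjoint X := hρs.sub hσs
  have hXf : IsFixed A X := hρ.isFixed.sub hA hσ.isFixed
  have pp := CFC.posPart_nonneg X
  have pn := CFC.negPart_nonneg X
  have hsum : ρ + X⁻ = σ + X⁺ := by
    have := CFC.posPart_sub_negPart X
    rw [sub_eq_iff_eq_add] at this
    rw [this, hX]; abel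
  have htr : ptr X⁻ = ptr X⁺ := by
    have := congrArg ptr hsum
    rw [ptr_add hρ.nonneg pn, ptr_add hσ.nonneg pp, hρ.ptr_eq, hσ.ptr_eq] at this
    exact (ENNReal.add_right_inj ENNReal.one_ne_top).1 this
  have hker : ∀ x ∈ Eᗮ, X x = 0 := fun x hx => by
    rw [hX, sub_apply, (supp_le_iff_orthogonal hρs hE.1.1).1 hρE x hx,
      (supp_le_iff_orthogonal hσs hE.1.1).1 hσE x hx, sub_zero]
  by_contra hne
  have hp : X⁺ ≠ 0 := by
    intro h
    rw [h, (ptr_eq_zero_iff le_rfl).2 rfl, ptr_eq_zero_iff pn] at htr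
    rw [h, htr, add_zero, add_zero] at hsum
    exact hne hsum
  have hn : X⁻ ≠ 0 := by
    intro h
    rw [h, (ptr_eq_zero_iff le_rfl).2 rfl, eq_comm, ptr_eq_zero_iff pp] at htr
    exact hp htr
  have h1 : supp X⁺ = E := hE.supp_eq hA (hXf.posPart hA hXs) pp ((supp_le_iff_orthogonal
    (.of_nonneg pp) hE.1.1).2 fun x hx => posPart_apply_eq_zero hXs (hker x hx)) hp
  have h2 : supp X⁻ = E := hE.supp_eq hA (hXf.negPart hA hXs) pn ((supp_le_iff_orthogonal
    (.of_nonneg pn) hE.1.1).2 fun x hx => negPart_apply_eq_zero hXs (hker x hx)) hn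
  -- `X⁻` vanishes on the support of `X⁺`, which is `E`, the support of `X⁻` itself; hence its
  -- square is zero.
  refine hn (eq_zero_of_star_mul_self ?_)
  ext x
  rw [(IsSelfAdjoint.of_nonneg pn).star_eq, mul_apply_eq]
  refine negPart_apply_of_mem_supp_posPart X ?_
  rw [h1, ← h2]
  exact mem_supp _ _

lemma IsMinimalStable.exists_eq_smul_of_nonneg (hA : IsStochastic A) {E : Submodule ℂ H}
    (hE : IsMinimalStable A E) {ρ X : H →L[ℂ] H} (hρ : IsFixedState A ρ) (hρE : supp ρ ≤ E)
    (hX : IsFixed A X) (h0 : 0 ≤ X) (hXE : supp X ≤ E) : ∃ t : ℂ, X = t • ρ := by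
  by_cases hne : X = 0
  · exact ⟨0, by simp [hne]⟩
  obtain ⟨h1, h2⟩ := isFixedState_normalize hX h0 hne
  have hc : (((ptr X).toReal⁻¹ : ℝ) : ℂ) ≠ 0 := by exact_mod_cast (inv_pos.2 h1).ne'
  refine ⟨(((ptr X).toReal⁻¹ : ℝ) : ℂ)⁻¹, ?_⟩
  rw [hE.fixedState_unique hA hρ h2 hρE (by rwa [supp_smul hc]), smul_smul, inv_mul_cancel₀ hc,
    one_smul]

lemma IsMinimalStable.exists_eq_smul_of_isSelfAdjoint (hA : IsStochastic A) {E : Submodule ℂ H}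
    (hE : IsMinimalStable A E) {ρ X : H →L[ℂ] H} (hρ : IsFixedState A ρ) (hρE : supp ρ ≤ E)
    (hX : IsFixed A X) (hs : IsSelfAdjoint X) (hXE : supp X ≤ E) : ∃ t : ℂ, X = t • ρ := by
  have hker := (supp_le_iff_orthogonal hs hE.1.1).1 hXE
  have pp := CFC.posPart_nonneg X
  have pn := CFC.negPart_nonneg X
  obtain ⟨t, ht⟩ := hE.exists_eq_smul_of_nonneg hA hρ hρE (hX.posPart hA hs) pp
    ((supp_le_iff_orthogonal (.of_nonneg pp) hE.1.1).2 fun x hx =>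
      posPart_apply_eq_zero hs (hker x hx))
  obtain ⟨u, hu⟩ := hE.exists_eq_smul_of_nonneg hA hρ hρE (hX.negPart hA hs) pn
    ((supp_le_iff_orthogonal (.of_nonneg pn) hE.1.1).2 fun x hx =>
      negPart_apply_eq_zero hs (hker x hx))
  exact ⟨t - u, by rw [sub_smul, ← ht, ← hu, CFC.posPart_sub_negPart X]⟩

/-- On a minimal stable subspace, the fixed trace-class operators are the multiples of the fixed
state. -/
lemma IsMinimalStable.exists_eq_smul (hA : IsStochastic A) {E : Submodule ℂ H}
    (hE : IsMinimalStable A E) {ρ X : H →L[ℂ] H} (hρ : IsFixedState A ρ) (hρE : supp ρ ≤ E)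
    (hX : IsFixed A X) (h1 : proj E * X = X) (h2 : X * proj E = X) : ∃ t : ℂ, X = t • ρ := by
  have h3 : proj E * star X = star X := by
    have := congrArg star h2
    rwa [star_mul, star_proj] at this
  obtain ⟨t, ht⟩ := hE.exists_eq_smul_of_isSelfAdjoint hA hρ hρE (hX.add hA hX.star)
    (IsSelfAdjoint.add_star_self X) ((supp_le_iff_proj_mul hE.1.1).2 (by rw [mul_add, h1, h3]))
  obtain ⟨u, hu⟩ := hE.exists_eq_smul_of_isSelfAdjoint hA hρ hρE
    ((hX.sub hA hX.star).smul Complex.I)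
    (by simp [isSelfAdjoint_iff, ← smul_neg]) ((supp_le_iff_proj_mul hE.1.1).2
      (by rw [mul_smul_comm, mul_sub, h1, h3]))
  -- From `X + X* = t ρ` and `i (X - X*) = u ρ`.
  refine ⟨2⁻¹ * (t - Complex.I * u), ?_⟩
  rw [mul_smul, sub_smul, mul_smul, ← ht, ← hu, smul_smul, Complex.I_mul_I, neg_one_smul]
  rw [show X + star X - -(X - star X) = (2 : ℂ) • X by rw [two_smul]; abel, smul_smul]
  norm_num

end Kraus

/-! ### Schur's lemma and partial isometries in the commutant. -/

section Intertwiners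

variable {H : Type*} [NormedAddCommGroup H] [InnerProductSpace ℂ H] [CompleteSpace H]
  {ι : Type*} {A : ι → H →L[ℂ] H}

lemma IsFixedState.proj_mul {ρ : H →L[ℂ] H} (h : IsFixedState A ρ) :
    proj (fixedSupport A) * ρ = ρ :=
  (supp_le_iff_proj_mul fixedSupport_isClosed).1 h.supp_le

lemma star_of_nonneg {ρ : H →L[ℂ] H} (h : 0 ≤ ρ) : star ρ = ρ := (IsSelfAdjoint.of_nonneg h).star_eq

lemma mul_proj_of_proj_mul {K : Submodule ℂ H} {ρ : H →L[ℂ] H} (h0 : 0 ≤ ρ)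
    (h : proj K * ρ = ρ) : ρ * proj K = ρ := by
  have := congrArg star h
  rwa [star_mul, star_of_nonneg h0, star_proj] at this

lemma IsFixedState.mul_proj {ρ : H →L[ℂ] H} (h : IsFixedState A ρ) :
    ρ * proj (fixedSupport A) = ρ :=
  mul_proj_of_proj_mul h.nonneg h.proj_mul

lemma IsFixedState.mul_mul (hA : IsStochastic A) {ρ S T : H →L[ℂ] H} (h : IsFixedState A ρ)
    (hS : S ∈ fixedCommutant A) (hT : T ∈ fixedCommutant A) : IsFixed A (S * ρ * T) :=
  h.isFixed.mul_mul hA h.proj_mul h.mul_proj hS hT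

/-- Some fixed state has nonzero compression to `E`, since otherwise `E` would be orthogonal to `R`.
The compression is fixed, and normalizing it gives the state. -/
lemma IsMinimalStable.exists_fixedState (hA : IsStochastic A) {E : Submodule ℂ H}
    (hE : IsMinimalStable A E) (hle : E ≤ fixedSupport A) :
    ∃ ρ, IsFixedState A ρ ∧ supp ρ = E := by
  have hP := proj_mem_fixedCommutant hA hE.1 hle
  obtain ⟨ρ, hρ, hne⟩ : ∃ ρ, IsFixedState A ρ ∧ proj E * ρ * proj E ≠ 0 := by
    by_contra! h
    refine hE.2.1 ((Submodule.eq_bot_iff _).2 fun x hx => ?_)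
    have h1 : fixedSupport A ≤ Eᗮ := by
      refine fixedSupport_le (Submodule.isClosed_orthogonal _) fun ρ hρ => ?_
      refine (supp_le_iff (Submodule.isClosed_orthogonal _)).2 fun y => ?_
      have h2 : ρ * proj E = 0 := by
        refine mul_eq_zero_of_conj_eq_zero hρ.nonneg ?_
        rw [star_proj]
        exact h ρ hρ
      have h3 := congrArg star h2
      rw [star_mul, star_proj, star_of_nonneg hρ.nonneg, star_zero] at h3
      exact proj_eq_zero_iff.1 (congrArg (fun T : H →L[ℂ] H => T y) h3)
    exact inner_self_eq_zero.1 (Submodule.inner_right_of_mem_orthogonal hx (h1 (hle hx)))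
  have h0 : 0 ≤ proj E * ρ * proj E := by
    have := star_right_conjugate_nonneg hρ.nonneg (proj E)
    rwa [star_proj] at this
  obtain ⟨h1, h2⟩ := isFixedState_normalize (hρ.mul_mul hA hP hP) h0 hne
  refine ⟨_, h2, hE.supp_eq hA h2.isFixed h2.nonneg ?_ h2.ne_zero⟩
  rw [supp_le_iff_proj_mul hE.1.1, mul_smul_comm, ← mul_assoc, ← mul_assoc, proj_mul_self]

lemma eq_smul_proj_of_mul_eq_smul {S ρ : H →L[ℂ] H} {t : ℂ} (h : S * ρ = t • ρ)
    (hS : S * proj (supp ρ) = S) : S = t • proj (supp ρ) := by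
  have h1 : supp ρ ≤ LinearMap.ker ((S - t • (1 : H →L[ℂ] H) : H →L[ℂ] H) : H →ₗ[ℂ] H) := by
    refine (supp_le_iff (ContinuousLinearMap.isClosed_ker _)).2 fun x => ?_
    have := congrArg (fun T : H →L[ℂ] H => T x) h
    exact sub_eq_zero.2 this
  rw [← hS]
  ext x
  exact sub_eq_zero.1 (h1 (proj_mem (supp_isClosed ρ) x))

/-- Schur's lemma on a minimal stable subspace. -/
lemma IsMinimalStable.star_mul_self_eq (hA : IsStochastic A) {E : Submodule ℂ H}
    (hE : IsMinimalStable A E) (hle : E ≤ fixedSupport A) {T : H →L[ℂ] H}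
    (hT : T ∈ fixedCommutant A) (h1 : T * proj E = T) (hne : T ≠ 0) :
    ∃ r : ℝ, 0 < r ∧ star T * T = (r : ℂ) • proj E := by
  obtain ⟨ρ, hρ, rfl⟩ := hE.exists_fixedState hA hle
  have h2 : proj (supp ρ) * star T = star T := by
    have := congrArg star h1
    rwa [star_mul, star_proj] at this
  -- `T* T ρ` is a fixed operator living on `E`, hence a multiple of `ρ`; density of the range of
  -- `ρ` in `E` then makes `T* T` scalar there.
  obtain ⟨t, ht⟩ := hE.exists_eq_smul hA hρ le_rfl
    (hρ.mul_mul hA (mul_mem (star_mem hT) hT) (one_mem _))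
    (by rw [mul_one, ← mul_assoc, ← mul_assoc, h2])
    (by rw [mul_one, mul_assoc, mul_proj_of_proj_mul hρ.nonneg (proj_supp_mul ρ)])
  rw [mul_one] at ht
  have h3 := eq_smul_proj_of_mul_eq_smul ht (by rw [mul_assoc, h1])
  obtain ⟨x, hx⟩ : ∃ x, T x ≠ 0 := by
    by_contra! h
    exact hne (ContinuousLinearMap.ext h)
  set y := proj (supp ρ) x
  have hTy : T y = T x := congrArg (fun S : H →L[ℂ] H => S x) h1
  have hy : y ≠ 0 := by
    intro h
    rw [h, map_zero] at hTy
    exact hx hTy.symm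
  have hyy : proj (supp ρ) y = y := proj_apply_of_mem (proj_mem (supp_isClosed ρ) x)
  have h4 := inner_star_mul_self T y
  rw [h3, smul_apply, hyy, inner_smul_right, inner_self_eq_norm_sq_to_K] at h4
  have hy' : (0 : ℝ) < ‖y‖ ^ 2 := by positivity
  refine ⟨‖T y‖ ^ 2 / ‖y‖ ^ 2, div_pos (by rw [hTy]; positivity) hy', ?_⟩
  rw [h3]
  congr 1
  rw [Complex.ofReal_div, eq_div_iff (by exact_mod_cast hy'.ne'), ← h4]
  simp

variable (A) in
/-- A partial isometry from `E` onto `F` that commutes with the Kraus operators. -/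
structure IsIntertwiner (Q : H →L[ℂ] H) (E F : Submodule ℂ H) : Prop where
  mem : Q ∈ fixedCommutant A
  star_mul_self : star Q * Q = proj E
  mul_star_self : Q * star Q = proj F

namespace IsIntertwiner

variable {Q Q' : H →L[ℂ] H} {E F G : Submodule ℂ H}

protected lemma star (h : IsIntertwiner A Q E F) : IsIntertwiner A (star Q) F E :=
  ⟨star_mem h.mem, by rw [star_star, h.mul_star_self], by rw [star_star, h.star_mul_self]⟩

lemma mul_proj (h : IsIntertwiner A Q E F) : Q * proj E = Q := by
  have h1 : Q * (1 - proj E) = 0 := by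
    refine eq_zero_of_star_mul_self ?_
    rw [star_mul, mul_assoc, ← mul_assoc (star Q), h.star_mul_self, mul_sub, mul_one, proj_mul_self,
      sub_self, mul_zero]
  rw [mul_sub, mul_one, sub_eq_zero] at h1
  exact h1.symm

lemma proj_mul (h : IsIntertwiner A Q E F) : proj F * Q = Q := by
  have := congrArg star h.star.mul_proj
  rwa [star_mul, star_star, star_proj] at this

lemma trans (h : IsIntertwiner A Q E F) (h' : IsIntertwiner A Q' F G) :
    IsIntertwiner A (Q' * Q) E G := by
  refine ⟨mul_mem h'.mem h.mem, ?_, ?_⟩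
  · rw [star_mul, mul_assoc, ← mul_assoc (star Q'), h'.star_mul_self, h.proj_mul, h.star_mul_self]
  · rw [star_mul, mul_assoc, ← mul_assoc Q, h.mul_star_self, ← mul_assoc, h'.mul_proj,
      h'.mul_star_self]

end IsIntertwiner

/-- A nonzero operator of the commutant between two minimal stable subspaces is proportional to
an intertwiner. -/
lemma exists_isIntertwiner (hA : IsStochastic A) {E F : Submodule ℂ H}
    (hE : IsMinimalStable A E) (hF : IsMinimalStable A F) (hEle : E ≤ fixedSupport A)
    (hFle : F ≤ fixedSupport A) {T : H →L[ℂ] H} (hT : T ∈ fixedCommutant A)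
    (h1 : T * proj E = T) (h2 : proj F * T = T) (hne : T ≠ 0) : ∃ Q, IsIntertwiner A Q E F := by
  obtain ⟨r, hr, h3⟩ := hE.star_mul_self_eq hA hEle hT h1 hne
  obtain ⟨s, hs, h4⟩ := hF.star_mul_self_eq hA hFle (star_mem hT)
    (by have := congrArg star h2; rwa [star_mul, star_proj] at this) (by simpa using hne)
  rw [star_star] at h4
  -- Both scalars arise from evaluating `T T* T`, so one normalization by `r^(-1/2)` serves both
  -- sides.
  have h5 : (s : ℂ) = r := by
    have h6 : (s : ℂ) • T = (r : ℂ) • T := by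
      calc (s : ℂ) • T = T * star T * T := by rw [h4, smul_mul_assoc, h2]
        _ = _ := by rw [mul_assoc, h3, mul_smul_comm, h1]
    exact smul_left_injective ℂ hne h6
  have h6 : (((√r)⁻¹ : ℝ) : ℂ) * (((√r)⁻¹ : ℝ) : ℂ) * (r : ℂ) = 1 := by
    have : (√r)⁻¹ * (√r)⁻¹ * r = 1 := by
      rw [← mul_inv, Real.mul_self_sqrt hr.le, inv_mul_cancel₀ hr.ne']
    exact_mod_cast this
  have h7 : star ((((√r)⁻¹ : ℝ) : ℂ) • T) = (((√r)⁻¹ : ℝ) : ℂ) • star T := by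
    rw [star_smul]
    simp
  refine ⟨(((√r)⁻¹ : ℝ) : ℂ) • T, (fixedCommutant A).smul_mem hT _, ?_, ?_⟩
  · rw [h7, smul_mul_smul_comm, h3, smul_smul, h6, one_smul]
  · rw [h7, smul_mul_smul_comm, h4, h5, smul_smul, h6, one_smul]

lemma exists_isIntertwiner_of_not_isOrtho (hA : IsStochastic A) {E F : Submodule ℂ H}
    (hE : IsMinimalStable A E) (hF : IsMinimalStable A F) (hEle : E ≤ fixedSupport A)
    (hFle : F ≤ fixedSupport A) (h : ¬ F ⟂ E) : ∃ Q, IsIntertwiner A Q E F := by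
  refine exists_isIntertwiner hA hE hF hEle hFle (T := proj F * proj E)
    (mul_mem (proj_mem_fixedCommutant hA hF.1 hFle) (proj_mem_fixedCommutant hA hE.1 hEle))
    (by rw [mul_assoc, proj_mul_self]) (by rw [← mul_assoc, proj_mul_self]) fun h0 => h ?_
  rw [Submodule.isOrtho_comm]
  intro x hx
  rw [← proj_eq_zero_iff]
  have := congrArg (fun T : H →L[ℂ] H => T x) h0
  simpa [mul_apply_eq, proj_apply_of_mem hx] using this

lemma proj_supp_posPart_mul (Y : H →L[ℂ] H) (hY : IsSelfAdjoint Y) : proj (supp Y⁺) * Y = Y⁺ := by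
  have h1 : Y⁻ * proj (supp Y⁺) = 0 := by
    ext x
    exact negPart_apply_of_mem_supp_posPart Y (proj_mem (supp_isClosed _) x)
  have h2 := congrArg star h1
  rw [star_mul, star_proj, star_of_nonneg (CFC.negPart_nonneg Y), star_zero] at h2
  nth_rw 2 [← CFC.posPart_sub_negPart Y]
  rw [mul_sub, proj_supp_mul, h2, sub_zero]

/-- If the support projection of the positive part of an off-diagonal operator has no off-diagonal
part, then this positive part vanishes. -/
lemma posPart_eq_zero_of_offDiagonal {P P' Y : H →L[ℂ] H} (hY : IsSelfAdjoint Y) (hP : star P = P)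
    (hP' : star P' = P') (h1 : P * Y * P = 0) (h2 : P' * Y * P' = 0)
    (h3 : P * Y + P' * Y = Y) (h : P * proj (supp Y⁺) * P' = 0) : Y⁺ = 0 := by
  have h0 := CFC.posPart_nonneg Y
  have h4 := proj_supp_posPart_mul Y hY
  have h' : P' * proj (supp Y⁺) * P = 0 := by
    have := congrArg star h
    simpa only [star_mul, star_proj, hP, hP', star_zero, mul_assoc] using this
  have h5 : Y⁺ * P = 0 := by
    refine mul_eq_zero_of_conj_eq_zero h0 ?_
    calc star P * Y⁺ * P = P * proj (supp Y⁺) * (P * Y + P' * Y) * P := by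
          rw [hP, h3, mul_assoc P _ Y, h4]
      _ = P * proj (supp Y⁺) * (P * Y * P) + (P * proj (supp Y⁺) * P') * Y * P := by noncomm_ring
      _ = 0 := by rw [h1, h]; simp
  have h6 : Y⁺ * P' = 0 := by
    refine mul_eq_zero_of_conj_eq_zero h0 ?_
    calc star P' * Y⁺ * P' = P' * proj (supp Y⁺) * (P * Y + P' * Y) * P' := by
          rw [hP', h3, mul_assoc P' _ Y, h4]
      _ = (P' * proj (supp Y⁺) * P) * Y * P' + P' * proj (supp Y⁺) * (P' * Y * P') := by
          noncomm_ring
      _ = 0 := by rw [h2, h']; simp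
  have h8 : Y * P + Y * P' = Y := by
    have := congrArg star h3
    rwa [star_add, star_mul, star_mul, hP, hP', hY.star_eq] at this
  calc Y⁺ = proj (supp Y⁺) * (Y * P + Y * P') := by rw [h8, h4]
    _ = Y⁺ * P + Y⁺ * P' := by rw [mul_add, ← mul_assoc, ← mul_assoc, h4]
    _ = 0 := by rw [h5, h6, add_zero]

/-- Two orthogonal minimal stable subspaces joined by a nonzero block of a fixed state are
intertwined. -/
lemma exists_isIntertwiner_of_block_ne_zero (hA : IsStochastic A) {E F : Submodule ℂ H}
    (hE : IsMinimalStable A E) (hF : IsMinimalStable A F) (hEle : E ≤ fixedSupport A)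
    (hFle : F ≤ fixedSupport A) (horth : F ⟂ E) {ρ : H →L[ℂ] H} (hρ : IsFixedState A ρ)
    (h : proj F * ρ * proj E ≠ 0) : ∃ Q, IsIntertwiner A Q E F := by
  have hPE := proj_mem_fixedCommutant hA hE.1 hEle
  have hPF := proj_mem_fixedCommutant hA hF.1 hFle
  have hFE := proj_mul_proj_of_isOrtho hE.1.1 horth
  have hEF := proj_mul_proj_of_isOrtho hF.1.1 horth.symm
  have hEE := proj_mul_self E
  have hFF := proj_mul_self F
  by_contra hno
  -- Without an intertwiner, Schur's lemma leaves no nonzero element of the commutant from `E` to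
  -- `F`; in particular the projection onto any stable subspace of `R` has no such block.
  have key : ∀ K, IsStable A K → K ≤ fixedSupport A → proj F * proj K * proj E = 0 := by
    intro K hK hKle
    by_contra hne
    exact hno (exists_isIntertwiner hA hE hF hEle hFle
      (mul_mem (mul_mem hPF (proj_mem_fixedCommutant hA hK hKle)) hPE)
      (by rw [mul_assoc, hEE]) (by rw [← mul_assoc, ← mul_assoc, hFF]) hne)
  have hρs := star_of_nonneg hρ.nonneg
  -- Adding the adjoint block makes a self-adjoint fixed operator, so that `Y⁺` and `Y⁻` have stable
  -- supports to which `key` applies.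
  set Y := proj F * ρ * proj E + proj E * ρ * proj F with hYdef
  have hY : IsFixed A Y := (hρ.mul_mul hA hPF hPE).add hA (hρ.mul_mul hA hPE hPF)
  have hYs : IsSelfAdjoint Y := by
    rw [isSelfAdjoint_iff, hYdef]
    simp only [star_add, star_mul, star_proj, hρs, ← mul_assoc]
    rw [add_comm]
  have e1 : proj F * Y = proj F * ρ * proj E := by
    rw [hYdef, mul_add]
    simp only [← mul_assoc]
    rw [hFF, hFE]; simp
  have e2 : proj E * Y = proj E * ρ * proj F := by
    rw [hYdef, mul_add]
    simp only [← mul_assoc]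
    rw [hEE, hEF]; simp
  have hker : ∀ x ∈ (fixedSupport A)ᗮ, Y x = 0 := by
    have h1 : Y * proj (fixedSupport A) = Y := by
      rw [hYdef, add_mul, mul_assoc _ (proj E), mul_assoc _ (proj F),
        proj_mul_proj_of_le' hE.1.1 hEle, proj_mul_proj_of_le' hF.1.1 hFle]
    intro x hx
    rw [← h1, mul_apply_eq, proj_eq_zero_iff.2 hx, map_zero]
  have main : ∀ Z : H →L[ℂ] H, IsFixed A Z → IsSelfAdjoint Z →
      (∀ x ∈ (fixedSupport A)ᗮ, Z x = 0) → proj F * Z * proj F = 0 → proj E * Z * proj E = 0 →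
      proj F * Z + proj E * Z = Z → Z⁺ = 0 := by
    intro Z hZ hZs hZk h1 h2 h3
    have pp := CFC.posPart_nonneg Z
    refine posPart_eq_zero_of_offDiagonal hZs (star_proj F) (star_proj E) h1 h2 h3
      (key _ (isStable_supp hA (hZ.posPart hA hZs) pp) ?_)
    exact (supp_le_iff_orthogonal (.of_nonneg pp) fixedSupport_isClosed).2 fun x hx =>
      posPart_apply_eq_zero hZs (hZk x hx)
  have m1 : proj F * Y * proj F = 0 := by rw [e1, mul_assoc, hEF, mul_zero]
  have m2 : proj E * Y * proj E = 0 := by rw [e2, mul_assoc, hFE, mul_zero]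
  have m3 : proj F * Y + proj E * Y = Y := by rw [e1, e2]
  have hp := main Y hY hYs hker m1 m2 m3
  have hn := main (-Y) hY.neg hYs.neg (fun x hx => by simp [hker x hx]) (by simp [m1])
    (by simp [m2]) (by rw [mul_neg, mul_neg, ← neg_add, m3])
  rw [CFC.posPart_neg] at hn
  have hY0 : Y = 0 := by rw [← CFC.posPart_sub_negPart Y, hp, hn, sub_zero]
  rw [hY0, mul_zero] at e1
  exact h e1.symm

lemma IsIntertwiner.eq_zero_of_apply_eq_zero {Q : H →L[ℂ] H} {E F : Submodule ℂ H}
    (hQ : IsIntertwiner A Q E F) {x : H} (hx : x ∈ E) (h : Q x = 0) : x = 0 := by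
  rw [← proj_apply_of_mem hx, ← hQ.star_mul_self, mul_apply_eq, h, map_zero]

/-- The graph of an intertwiner is a minimal stable subspace. -/
lemma IsIntertwiner.exists_graph {E F : Submodule ℂ H}
    (hE : IsMinimalStable A E) (hF : IsMinimalStable A F) (hEle : E ≤ fixedSupport A)
    (hFle : F ≤ fixedSupport A) (hP : proj E ∈ fixedCommutant A) (horth : F ⟂ E) {Q : H →L[ℂ] H}
    (hQ : IsIntertwiner A Q E F) :
    ∃ K, IsMinimalStable A K ∧ ¬ K ⟂ E ∧ ∀ W : Submodule ℂ H, W ⟂ F → ¬ K ≤ W := by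
  have hFE := proj_mul_proj_of_isOrtho hE.1.1 horth
  have hEF := proj_mul_proj_of_isOrtho hF.1.1 horth.symm
  have hEQ : proj E * Q = 0 := by rw [← hQ.proj_mul, ← mul_assoc, hEF, zero_mul]
  -- `G` is an oblique idempotent in the commutant whose range is the graph of `Q`; the graph is
  -- thus the closed subspace `ker (G - 1)`, stable under the Kraus operators.
  set G := proj E + Q with hG
  have hGm : G ∈ fixedCommutant A := add_mem hP hQ.mem
  have hGP : G * proj E = G := by rw [hG, add_mul, proj_mul_self, hQ.mul_proj]
  have hPG : proj E * G = proj E := by rw [hG, mul_add, proj_mul_self, hEQ, add_zero]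
  have hGG : G * G = G := by rw [← hGP, mul_assoc, ← mul_assoc (proj E), hPG, proj_mul_self]
  have hFG : proj F * G = Q := by rw [hG, mul_add, hFE, hQ.proj_mul, zero_add]
  have hGR : ∀ x, G x ∈ fixedSupport A := fun x => by
    refine Submodule.add_mem _ (hEle (proj_mem hE.1.1 x)) (hFle ?_)
    rw [← hQ.proj_mul]
    exact proj_mem hF.1.1 _
  have app : ∀ {S T U : H →L[ℂ] H}, S * T = U → ∀ x, S (T x) = U x := by
    rintro S T U rfl x
    rfl
  set K := LinearMap.ker ((G - 1 : H →L[ℂ] H) : H →ₗ[ℂ] H) with hK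
  have memK : ∀ {x}, x ∈ K ↔ G x = x := fun {x} => sub_eq_zero
  obtain ⟨x₀, hx₀, hne⟩ := (Submodule.ne_bot_iff _).1 hE.2.1
  have hGK : ∀ x, G x ∈ K := fun x => memK.2 (app hGG x)
  refine ⟨K, ⟨⟨ContinuousLinearMap.isClosed_ker _, fun p x hx => ?_⟩, ?_, ?_⟩, ?_, ?_⟩
  · rw [memK] at hx ⊢
    rw [← kraus_apply_comm hGm p (hx ▸ hGR x), hx]
  · refine (Submodule.ne_bot_iff _).2 ⟨G x₀, hGK x₀, fun h => hne ?_⟩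
    rw [← proj_apply_of_mem hx₀, ← app hPG, h, map_zero]
  -- Minimality is transported from `E`: a stable part of the graph is the image under `G` of a
  -- stable part of `E`.
  · intro K' hK' hle hne'
    set E₀ : Submodule ℂ H := E ⊓ K'.comap (G : H →ₗ[ℂ] H) with hE₀
    have h1 : IsStable A E₀ := by
      refine ⟨hE.1.1.inter (hK'.1.preimage G.continuous), fun p x hx => ⟨hE.1.2 p x hx.1, ?_⟩⟩
      change G (A p x) ∈ K'
      rw [← kraus_apply_comm hGm p (hEle hx.1)]
      exact hK'.2 p _ hx.2
    have h2 : E₀ ≠ ⊥ := by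
      obtain ⟨z, hz, hz0⟩ := (Submodule.ne_bot_iff _).1 hne'
      have hz1 : G (proj E z) = z := (app hGP z).trans (memK.1 (hle hz))
      refine (Submodule.ne_bot_iff _).2 ⟨proj E z, ⟨proj_mem hE.1.1 z, ?_⟩, fun h => hz0 ?_⟩
      · change G (proj E z) ∈ K'
        rwa [hz1]
      · rw [← hz1, h, map_zero]
    have h3 := hE.2.2 E₀ h1 inf_le_left h2
    refine le_antisymm hle fun z hz => ?_
    have hz1 : G (proj E z) = z := (app hGP z).trans (memK.1 hz)
    have hz2 : proj E z ∈ E₀ := h3.ge (proj_mem hE.1.1 z)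
    rw [← hz1]
    exact hz2.2
  · intro h
    refine hne ?_
    rw [← proj_apply_of_mem hx₀, ← app hPG]
    exact proj_eq_zero_iff.2 (h (hGK x₀))
  · intro W hW hle
    refine hne (hQ.eq_zero_of_apply_eq_zero hx₀ ?_)
    rw [← app hFG]
    exact proj_eq_zero_iff.2 (hW (hle (hGK x₀)))

lemma IsIntertwiner.isFixedState_conj (hA : IsStochastic A) {Q : H →L[ℂ] H} {E F : Submodule ℂ H}
    (hQ : IsIntertwiner A Q E F) {ρ : H →L[ℂ] H} (hρ : IsFixedState A ρ)
    (hE : IsClosed (E : Set H)) (hρE : supp ρ ≤ E) : IsFixedState A (Q * ρ * star Q) := by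
  have h0 := hρ.nonneg
  have h1 := (supp_le_iff_proj_mul hE).1 hρE
  refine ⟨(isState_iff _).2 ⟨star_right_conjugate_nonneg h0 _, ?_⟩,
    (hρ.mul_mul hA hQ.mem (star_mem hQ.mem)).2⟩
  have h2 : proj E * ρ * star (proj E) = ρ := by
    rw [h1, star_proj, mul_proj_of_proj_mul h0 h1]
  have h3 := ptr_conj h0 (proj E)
  rw [h2] at h3
  rw [ptr_conj h0, ← hρ.ptr_eq, h3, ← ptr_star_mul_self, ← ptr_star_mul_self, star_mul, star_mul,
    mul_assoc, ← mul_assoc (star Q), hQ.star_mul_self, star_proj, mul_assoc, ← mul_assoc (proj E),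
    proj_mul_self]

end Intertwiners

/-! ### Stability tested on rank-one operators. -/

section RankOne

variable {H : Type*} [NormedAddCommGroup H] [InnerProductSpace ℂ H] [CompleteSpace H]
  {ι : Type*} {A : ι → H →L[ℂ] H}

lemma rankOne_self_nonneg (x : H) : 0 ≤ InnerProductSpace.rankOne ℂ x x :=
  (ContinuousLinearMap.nonneg_iff_isPositive _).2 (InnerProductSpace.isPositive_rankOne_self x)

lemma inner_rankOne_self (x y : H) :
    (⟪y, InnerProductSpace.rankOne ℂ x x y⟫_ℂ).re = ‖⟪y, x⟫_ℂ‖ ^ 2 := by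
  rw [InnerProductSpace.rankOne_apply, inner_smul_right, ← inner_conj_symm x y, RCLike.conj_mul]
  norm_cast

lemma isTraceClass_rankOne_self (x : H) : IsTraceClass (InnerProductSpace.rankOne ℂ x x) := by
  rw [isTraceClass_iff_ptr (rankOne_self_nonneg x), ptr]
  simp only [inner_rankOne_self, ofReal_norm_sq, tsum_enorm_inner_sq]
  simp

/-- A closed subspace is stable if and only if the Kraus map preserves the positive trace-class
operators that it supports. -/
lemma isStable_iff (hA : IsStochastic A) {K : Submodule ℂ H} :
    IsStable A K ↔ IsClosed (K : Set H) ∧ ∀ ρ : H →L[ℂ] H, ρ.IsPositive → IsTraceClass ρ →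
      supp ρ ≤ K → supp (krausMap A ρ) ≤ K := by
  refine and_congr_right fun hK => ⟨fun h ρ _ ht hle => ?_, fun h p x hx => ?_⟩
  · refine (supp_le_iff hK).2 fun x => mem_of_forall_orthogonal hK fun y hy => ?_
    refine (hasSum_inner_krausMap hA ht y x).unique ?_
    convert hasSum_zero with p
    rw [inner_star_left]
    exact Submodule.inner_left_of_mem_orthogonal (h p _ (hle (mem_supp ρ _))) hy
  · have ht := isTraceClass_rankOne_self x
    have h0 := rankOne_self_nonneg x
    have h1 := h _ ((ContinuousLinearMap.nonneg_iff_isPositive _).1 h0) ht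
      ((supp_le_iff hK).2 fun y => Submodule.smul_mem _ _ hx)
    refine mem_of_forall_orthogonal hK fun y hy => ?_
    have h2 := (supp_le_iff_orthogonal (.of_nonneg (krausMap_nonneg h0)) hK).1 h1 y hy
    have h3 := Complex.hasSum_re (hasSum_inner_krausMap hA ht y y)
    rw [h2, inner_zero_right, Complex.zero_re, hasSum_zero_iff_of_nonneg
      (fun p => re_inner_nonneg h0 _)] at h3
    have h4 := congrFun h3 p
    -- For `y` orthogonal to `K`, the image of `|x⟩⟨x|` has vanishing expectation `∑ |⟪(A p)* y,
    -- x⟫|²`, so every `A p x` is orthogonal to `y`.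
    simp only [Pi.zero_apply, inner_rankOne_self, sq_eq_zero_iff, norm_eq_zero] at h4
    rw [← inner_star_left, h4]

end RankOne

/-! ### From Kraus families back to walks and their decompositions. -/

section Bridge

variable {V : Type*} {h : V → Type*} [∀ i, NormedAddCommGroup (h i)]
  [∀ i, InnerProductSpace ℂ (h i)] [∀ i, CompleteSpace (h i)]

namespace OQRW

variable (M : OQRW h)

/-- The Kraus operators of the walk as a family indexed by pairs of sites. -/
def krausFamily (p : V × V) : Space h →L[ℂ] Space h := M.kraus p.1 p.2

lemma norm_krausFamily_apply (i j : V) (x : Space h) :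
    ‖M.krausFamily (i, j) x‖ = ‖M.L i j (x j)‖ := by
  classical exact lp.norm_single (by norm_num) i _

lemma hasSum_norm_sq (j : V) (x : h j) : HasSum (fun i => ‖M.L i j x‖ ^ 2) (‖x‖ ^ 2) := by
  have h1 := Complex.hasSum_re ((M.stochastic j x).mapL (innerSL ℂ x))
  simp only [innerSL_apply_apply] at h1
  convert h1 using 1
  · funext i
    rw [ContinuousLinearMap.adjoint_inner_right, inner_self_eq_norm_sq_to_K]
    norm_cast
  · rw [inner_self_eq_norm_sq_to_K]
    norm_cast

lemma isStochastic : IsStochastic M.krausFamily := by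
  intro x
  rw [← (Equiv.prodComm V V).hasSum_iff]
  have h1 : ∀ j, HasSum (fun i => ‖M.krausFamily (i, j) x‖ ^ 2) (‖x j‖ ^ 2) := fun j => by
    simpa only [norm_krausFamily_apply] using M.hasSum_norm_sq j (x j)
  have h2 : HasSum (fun j => ‖x j‖ ^ 2) (‖x‖ ^ 2) := by
    simpa using lp.hasSum_norm (p := 2) (by norm_num) x
  have h3 : Summable ((fun p => ‖M.krausFamily p x‖ ^ 2) ∘ Equiv.prodComm V V) := by
    rw [summable_prod_of_nonneg (fun _ => by simp only [Function.comp_apply]; positivity)]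
    exact ⟨fun j => (h1 j).summable, h2.summable.congr fun j => (h1 j).tsum_eq.symm⟩
  have h4 := h3.hasSum.prod_fiberwise h1
  rw [← h4.unique h2]
  exact h3.hasSum

lemma map_eq : M.map = krausMap M.krausFamily := by
  funext ρ
  exact tsum_congr fun p => (mul_assoc _ _ _).symm

lemma isInvariantState_iff {ρ : Space h →L[ℂ] Space h} :
    M.IsInvariantState ρ ↔ IsFixedState M.krausFamily ρ := by
  rw [IsInvariantState, IsFixedState, map_eq]

lemma isInvariant_iff {ρ : Space h →L[ℂ] Space h} :
    M.IsInvariant ρ ↔ IsFixed M.krausFamily ρ := by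
  rw [IsInvariant, IsFixed, map_eq]

lemma isEnclosure_iff {K : Submodule ℂ (Space h)} :
    M.IsEnclosure K ↔ IsStable M.krausFamily K := by
  rw [isStable_iff M.isStochastic, IsEnclosure, map_eq]

lemma isMinimalEnclosure_iff {K : Submodule ℂ (Space h)} :
    M.IsMinimalEnclosure K ↔ IsMinimalStable M.krausFamily K := by
  simp only [IsMinimalEnclosure, IsMinimalStable, isEnclosure_iff]

lemma recurrentSpace_eq : M.recurrentSpace = fixedSupport M.krausFamily := by
  simp only [recurrentSpace, fixedSupport, isInvariantState_iff]

end OQRW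

namespace Generators

variable {M : OQRW h} {A B : Type*} {C : B → Type*} {G : Generators h A B C}

lemma block_eq (ρ : Space h →L[ℂ] Space h) (k l : Block A B C) :
    G.block M ρ k l = proj (G.space M k) * (ρ * proj (G.space M l)) := rfl

variable (M G) in
lemma sumB_isClosed (b : B) (S : Set (C b)) : IsClosed (G.sumB M b S : Set (Space h)) :=
  Submodule.isClosed_topologicalClosure (⨆ c ∈ S, G.encB M b c)

namespace IsDecomposition

variable (hG : G.IsDecomposition M)
include hG

lemma space_le_fixedSupport {k : Block A B C} (hk : k ≠ .zero) :
    G.space M k ≤ fixedSupport M.krausFamily := by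
  intro x hx
  refine mem_of_forall_orthogonal fixedSupport_isClosed fun y hy => ?_
  rw [← M.recurrentSpace_eq] at hy
  exact Submodule.inner_left_of_mem_orthogonal hx (hG.orthogonal hk.symm hy)

lemma isMinimalStable_space {k : Block A B C} (hk : k ≠ .zero) :
    IsMinimalStable M.krausFamily (G.space M k) := by
  rw [← M.isMinimalEnclosure_iff]
  cases k with
  | zero => exact absurd rfl hk
  | single a => exact hG.minimal_encA a
  | family b c => exact hG.minimal_encB b c

lemma sumB_isOrtho {b : B} {S : Set (C b)} {k : Block A B C} (hk : ∀ c ∈ S, .family b c ≠ k) :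
    G.sumB M b S ⟂ G.space M k :=
  Submodule.topologicalClosure_minimal _
    (iSup₂_le fun c hc => hG.orthogonal (hk c hc)) (Submodule.isClosed_orthogonal _)

/-- For `x` in `K`, the remainder after projecting to the `S`-sum lies in the sum over the
complement of `S`, and is also orthogonal to it. -/
lemma le_sumB {b : B} {S : Set (C b)} {K : Submodule ℂ (Space h)}
    (hK : K ≤ G.sumB M b Set.univ) (hKS : ∀ c ∉ S, K ⟂ G.encB M b c) :
    K ≤ G.sumB M b S := by
  have hS := sumB_isClosed M G b S
  have hcl := (sumB_isClosed M G b Sᶜ).preimage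
    (1 - proj (G.sumB M b S) : Space h →L[ℂ] Space h).continuous
  have hle : G.sumB M b Set.univ ≤ (G.sumB M b Sᶜ).comap
      ((1 - proj (G.sumB M b S) : Space h →L[ℂ] Space h) : Space h →ₗ[ℂ] Space h) := by
    refine Submodule.topologicalClosure_minimal _ (iSup₂_le fun c _ x hx => ?_) hcl
    change x - proj (G.sumB M b S) x ∈ G.sumB M b Sᶜ
    have mem : ∀ {T : Set (C b)}, c ∈ T → x ∈ G.sumB M b T := fun hc =>
      Submodule.le_topologicalClosure _ (le_iSup₂ (f := fun c _ => G.encB M b c) c hc hx)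
    by_cases hc : c ∈ S
    · rw [proj_apply_of_mem (mem hc), sub_self]
      exact zero_mem _
    · have h1 : G.sumB M b S ⟂ G.space M (.family b c) := hG.sumB_isOrtho fun c' hc' h => by
        cases h
        exact hc hc'
      rw [proj_eq_zero_iff.2 (h1.symm hx), sub_zero]
      exact mem hc
  intro x hx
  have h1 : x - proj (G.sumB M b S) x ∈ G.sumB M b Sᶜ := hle (hK hx)
  have h2 : x - proj (G.sumB M b S) x ∈ (G.sumB M b Sᶜ)ᗮ := by
    refine Submodule.sub_mem _ ?_ ?_
    · have h3 : G.sumB M b Sᶜ ≤ Kᗮ := Submodule.topologicalClosure_minimal _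
        (iSup₂_le fun c hc => (hKS c hc).symm) (Submodule.isClosed_orthogonal _)
      exact Submodule.orthogonal_le h3 (Submodule.le_orthogonal_orthogonal K hx)
    · have h3 : G.sumB M b Sᶜ ≤ (G.sumB M b S)ᗮ := Submodule.topologicalClosure_minimal _
        (iSup₂_le fun c hc => (hG.sumB_isOrtho (k := .family b c) fun c' hc' h => by
          cases h
          exact hc hc').symm) (Submodule.isClosed_orthogonal _)
      exact Submodule.orthogonal_le h3 (Submodule.le_orthogonal_orthogonal _ (proj_mem hS x))
  have h3 : x - proj (G.sumB M b S) x = 0 :=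
    inner_self_eq_zero.1 (Submodule.inner_right_of_mem_orthogonal h1 h2)
  rw [sub_eq_zero.1 h3]
  exact proj_mem hS x

/-- The members of a family are pairwise intertwined. -/
lemma exists_isIntertwiner (b : B) (c c' : C b) :
    ∃ Q, IsIntertwiner M.krausFamily Q (G.encB M b c) (G.encB M b c') := by
  have hA := M.isStochastic
  have hm : ∀ c, IsMinimalStable M.krausFamily (G.encB M b c) := fun c =>
    hG.isMinimalStable_space (k := .family b c) (by simp)
  have hl : ∀ c, G.encB M b c ≤ fixedSupport M.krausFamily := fun c =>
    hG.space_le_fixedSupport (k := .family b c) (by simp)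
  -- The members intertwined with `c` form a nonempty part of the family having its closure
  -- property, so minimality makes it the whole family.
  set S : Set (C b) :=
    {d | ∃ Q, IsIntertwiner M.krausFamily Q (G.encB M b c) (G.encB M b d)} with hS
  have hcS : c ∈ S := ⟨proj (G.encB M b c), proj_mem_fixedCommutant hA (hm c).1 (hl c),
    by rw [star_proj, proj_mul_self], by rw [star_proj, proj_mul_self]⟩
  suffices hSu : S = Set.univ from hSu.ge (Set.mem_univ c')
  by_contra hne
  refine hG.minimal_family b S ⟨c, hcS⟩ hne fun d hd K hK hKd => ?_
  have hKu := hG.closed_family b d K hK hKd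
  have hKle : K ≤ fixedSupport M.krausFamily := hKu.trans
    (Submodule.topologicalClosure_minimal _ (iSup₂_le fun c _ => hl c) fixedSupport_isClosed)
  rw [M.isMinimalEnclosure_iff] at hK
  refine hG.le_sumB hKu fun e he => ?_
  by_contra hKe
  obtain ⟨Q, hQ⟩ := hd
  obtain ⟨Q₁, hQ₁⟩ := exists_isIntertwiner_of_not_isOrtho hA (hm d) hK (hl d) hKle hKd
  obtain ⟨Q₂, hQ₂⟩ := exists_isIntertwiner_of_not_isOrtho hA (hm e) hK (hl e) hKle hKe
  -- An enclosure `K` oblique to both `d` and `e` would link them: compose `c → d → K → e`.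
  exact he ⟨_, (hQ.trans hQ₁).trans hQ₂.star⟩

/-- The graph would be a minimal enclosure not orthogonal to `E_a`, hence equal to `E_a`; but it has
a nonzero component in the target, which is orthogonal to `E_a`. -/
lemma not_isIntertwiner_single {a : A} {l : Block A B C} (hl : l ≠ .zero) (hne : l ≠ .single a)
    {Q : Space h →L[ℂ] Space h}
    (hQ : IsIntertwiner M.krausFamily Q (G.space M (.single a)) (G.space M l)) : False := by
  have hk : Block.single a ≠ (.zero : Block A B C) := by simp
  have hE := hG.isMinimalStable_space hk
  obtain ⟨K, hK, hKE, hKW⟩ := hQ.exists_graph hE (hG.isMinimalStable_space hl)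
    (hG.space_le_fixedSupport hk) (hG.space_le_fixedSupport hl)
    (proj_mem_fixedCommutant M.isStochastic hE.1 (hG.space_le_fixedSupport hk)) (hG.orthogonal hne)
  exact hKW _ (hG.orthogonal hne.symm)
    (hG.isolated a K (M.isMinimalEnclosure_iff.2 hK) hKE).le

lemma not_isIntertwiner_family {b : B} {c : C b} {l : Block A B C} (hl : l ≠ .zero)
    (hne : ∀ c', .family b c' ≠ l) {Q : Space h →L[ℂ] Space h}
    (hQ : IsIntertwiner M.krausFamily Q (G.space M (.family b c)) (G.space M l)) : False := by
  have hk : Block.family b c ≠ (.zero : Block A B C) := by simp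
  have hE := hG.isMinimalStable_space hk
  obtain ⟨K, hK, hKE, hKW⟩ := hQ.exists_graph hE (hG.isMinimalStable_space hl)
    (hG.space_le_fixedSupport hk) (hG.space_le_fixedSupport hl)
    (proj_mem_fixedCommutant M.isStochastic hE.1 (hG.space_le_fixedSupport hk))
    (hG.orthogonal (hne c).symm)
  exact hKW _ (hG.sumB_isOrtho fun c' _ => hne c')
    (hG.closed_family b c K (M.isMinimalEnclosure_iff.2 hK) hKE)

lemma block_zero_left {ρ : Space h →L[ℂ] Space h} (hρ : M.IsInvariantState ρ) (l : Block A B C) :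
    G.block M ρ .zero l = 0 := by
  rw [M.isInvariantState_iff] at hρ
  have h1 : proj M.decaySpace * ρ = 0 := by
    refine ContinuousLinearMap.ext fun x => ?_
    refine proj_eq_zero_iff.2 (Submodule.le_orthogonal_orthogonal _ ?_)
    rw [M.recurrentSpace_eq]
    exact hρ.supp_le (mem_supp ρ x)
  rw [block_eq, ← mul_assoc]
  exact (congrArg (· * _) h1).trans (zero_mul _)

lemma star_block {ρ : Space h →L[ℂ] Space h} (hρ : M.IsInvariantState ρ) (k l : Block A B C) :
    star (G.block M ρ k l) = G.block M ρ l k := by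
  rw [block_eq, block_eq, star_mul, star_mul, star_proj, star_proj,
    star_of_nonneg (M.isInvariantState_iff.1 hρ).nonneg, mul_assoc]

/-- A nonzero off-diagonal block of an invariant state yields an intertwiner. -/
lemma exists_isIntertwiner_of_block_ne_zero {ρ : Space h →L[ℂ] Space h} (hρ : M.IsInvariantState ρ)
    {k l : Block A B C} (hk : k ≠ .zero) (hl : l ≠ .zero) (hkl : k ≠ l)
    (hne : G.block M ρ k l ≠ 0) :
    ∃ Q, IsIntertwiner M.krausFamily Q (G.space M l) (G.space M k) :=
  OQRWalk.exists_isIntertwiner_of_block_ne_zero M.isStochastic (hG.isMinimalStable_space hl)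
    (hG.isMinimalStable_space hk) (hG.space_le_fixedSupport hl) (hG.space_le_fixedSupport hk)
    (hG.orthogonal hkl) (M.isInvariantState_iff.1 hρ) (by rwa [mul_assoc, ← block_eq])

lemma block_eq_zero {ρ : Space h →L[ℂ] Space h} (hρ : M.IsInvariantState ρ)
    {k l : Block A B C} (hkl : k ≠ l)
    (hf : ∀ b c c', ¬ (k = .family b c ∧ l = .family b c')) : G.block M ρ k l = 0 := by
  by_cases hk : k = .zero
  · rw [hk, hG.block_zero_left hρ]
  by_cases hl : l = .zero
  · rw [← hG.star_block hρ, hl, hG.block_zero_left hρ, star_zero]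
  by_contra hne
  obtain ⟨Q, hQ⟩ := hG.exists_isIntertwiner_of_block_ne_zero hρ hk hl hkl hne
  cases l with
  | zero => exact hl rfl
  | single a => exact hG.not_isIntertwiner_single hk hkl hQ
  | family b c => exact hG.not_isIntertwiner_family hk (fun c' hc' => hf b c' c ⟨hc'.symm, rfl⟩) hQ

lemma isInvariant_block {ρ : Space h →L[ℂ] Space h} (hρ : M.IsInvariantState ρ)
    {k l : Block A B C} (hk : k ≠ .zero) (hl : l ≠ .zero) : M.IsInvariant (G.block M ρ k l) := by
  rw [M.isInvariant_iff, block_eq, ← mul_assoc]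
  exact (M.isInvariantState_iff.1 hρ).mul_mul M.isStochastic
    (proj_mem_fixedCommutant M.isStochastic (hG.isMinimalStable_space hk).1
      (hG.space_le_fixedSupport hk))
    (proj_mem_fixedCommutant M.isStochastic (hG.isMinimalStable_space hl).1
      (hG.space_le_fixedSupport hl))

lemma exists_block_self_eq_smul {ρ σ : Space h →L[ℂ] Space h} (hρ : M.IsInvariantState ρ)
    {k : Block A B C} (hk : k ≠ .zero) (hσ : M.IsInvariantState σ)
    (hσk : supp σ ≤ G.space M k) : ∃ t : ℂ, G.block M ρ k k = t • σ := by
  refine (hG.isMinimalStable_space hk).exists_eq_smul M.isStochastic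
    (M.isInvariantState_iff.1 hσ) hσk (M.isInvariant_iff.1 (hG.isInvariant_block hρ hk hk)) ?_ ?_
  · rw [block_eq, ← mul_assoc, proj_mul_self]
  · rw [block_eq, mul_assoc, mul_assoc, proj_mul_self]

/-- `Q ρ P_l` is a fixed operator on the single minimal space `E_l`, hence a multiple of `σ`;
applying `Q*` recovers the block. -/
lemma exists_block_eq_smul {ρ σ Q : Space h →L[ℂ] Space h} (hρ : M.IsInvariantState ρ)
    {k l : Block A B C} (hl : l ≠ .zero) (hσ : M.IsInvariantState σ)
    (hσl : supp σ ≤ G.space M l)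
    (hQ : IsIntertwiner M.krausFamily Q (G.space M k) (G.space M l)) :
    ∃ t : ℂ, G.block M ρ k l = t • (star Q * σ) := by
  have hP := proj_mem_fixedCommutant M.isStochastic (hG.isMinimalStable_space hl).1
    (hG.space_le_fixedSupport hl)
  obtain ⟨t, ht⟩ := (hG.isMinimalStable_space hl).exists_eq_smul M.isStochastic
    (M.isInvariantState_iff.1 hσ) hσl
    ((M.isInvariantState_iff.1 hρ).mul_mul M.isStochastic hQ.mem hP)
    (by rw [← mul_assoc, ← mul_assoc, hQ.proj_mul]) (by rw [mul_assoc, proj_mul_self])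
  refine ⟨t, ?_⟩
  rw [← mul_smul_comm, ← ht, ← mul_assoc, ← mul_assoc, hQ.star_mul_self, mul_assoc,
    block_eq]

lemma exists_block_ne_zero {σ Q : Space h →L[ℂ] Space h} {k l : Block A B C} (hk : k ≠ .zero)
    (hl : l ≠ .zero) (hkl : k ≠ l) (hσ : M.IsInvariantState σ) (hσk : supp σ ≤ G.space M k)
    (hQ : IsIntertwiner M.krausFamily Q (G.space M k) (G.space M l)) :
    ∃ ρ, M.IsInvariantState ρ ∧ G.block M ρ k l ≠ 0 := by
  rw [M.isInvariantState_iff] at hσ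
  have hE := hG.isMinimalStable_space hk
  have hF := hG.isMinimalStable_space hl
  set P := proj (G.space M k) with hPdef
  have hPm : P ∈ fixedCommutant M.krausFamily :=
    proj_mem_fixedCommutant M.isStochastic hE.1 (hG.space_le_fixedSupport hk)
  have hPF : P * proj (G.space M l) = 0 := proj_mul_proj_of_isOrtho hF.1.1 (hG.orthogonal hkl)
  have hPs : star P = P := star_proj _
  have hσP : P * σ = σ := (supp_le_iff_proj_mul hE.1.1).1 hσk
  have hσP' : σ * P = σ := mul_proj_of_proj_mul hσ.nonneg hσP
  have hPQ : P * Q = 0 := by rw [← hQ.proj_mul, ← mul_assoc, hPF, zero_mul]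
  -- `σ` transported to the graph of `Q`: this fixed positive operator has off-diagonal block `σ
  -- Q*`.
  set X := (P + Q) * σ * star (P + Q) with hX
  have hXf : IsFixed M.krausFamily X := hσ.mul_mul M.isStochastic (add_mem hPm hQ.mem)
    (star_mem (add_mem hPm hQ.mem))
  have hX0 : 0 ≤ X := star_right_conjugate_nonneg hσ.nonneg _
  have hPX : P * X * proj (G.space M l) = σ * star Q := by
    have h1 : P * (P + Q) = P := by rw [mul_add, hPQ, add_zero, hPdef, proj_mul_self]
    have h2 : star (P + Q) * proj (G.space M l) = star Q := by
      rw [star_add, add_mul, hPs, hPF, zero_add]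
      exact hQ.star.mul_proj
    rw [hX, ← mul_assoc, ← mul_assoc, h1, hσP, mul_assoc, h2]
  have hne : σ * star Q ≠ 0 := by
    intro h0
    refine hσ.ne_zero ?_
    rw [← hσP', hPdef, ← hQ.star_mul_self, ← mul_assoc, h0, zero_mul]
  have hXne : X ≠ 0 := by
    intro h0
    rw [h0, mul_zero, zero_mul] at hPX
    exact hne hPX.symm
  obtain ⟨h1, h2⟩ := isFixedState_normalize hXf hX0 hXne
  refine ⟨_, M.isInvariantState_iff.2 h2, ?_⟩
  rw [block_eq, smul_mul_assoc, mul_smul_comm, ← mul_assoc, hPX]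
  exact smul_ne_zero (by exact_mod_cast (inv_pos.2 h1).ne') hne

lemma exists_invariantState {k : Block A B C} (hk : k ≠ .zero) :
    ∃ ρ, M.IsUniqueInvariantStateOn (G.space M k) ρ ∧ supp ρ = G.space M k := by
  have hE := hG.isMinimalStable_space hk
  obtain ⟨ρ, h1, h2⟩ := hE.exists_fixedState M.isStochastic (hG.space_le_fixedSupport hk)
  exact ⟨ρ, ⟨⟨M.isInvariantState_iff.2 h1, h2.le⟩, fun σ hσ hle => hE.fixedState_unique
    M.isStochastic (M.isInvariantState_iff.1 hσ) h1 hle h2.le⟩, h2⟩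

end IsDecomposition

end Generators

end Bridge

end OQRWalk

end

/-! ### Assembly. -/

theorem mainTheorem1 {V : Type*} [Countable V] {h : V → Type*} [∀ i, NormedAddCommGroup (h i)]
    [∀ i, InnerProductSpace ℂ (h i)] [∀ i, CompleteSpace (h i)]
    [∀ i, TopologicalSpace.SeparableSpace (h i)] (M : OQRWalk.OQRW h)
    {A B : Type*} {C : B → Type*} (G : OQRWalk.Generators h A B C) (hG : G.IsDecomposition M) :
    ∃ (ρA : A → OQRWalk.Space h →L[ℂ] OQRWalk.Space h)
      (ρB : ∀ b, C b → OQRWalk.Space h →L[ℂ] OQRWalk.Space h)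
      (Q : ∀ b, C b → C b → OQRWalk.Space h →L[ℂ] OQRWalk.Space h),
      -- the invariant states of the minimal enclosures
      (∀ a, M.IsUniqueInvariantStateOn (G.encA M a) (ρA a) ∧
        OQRWalk.supp (ρA a) = G.encA M a) ∧
      (∀ b c, M.IsUniqueInvariantStateOn (G.encB M b c) (ρB b c) ∧
        OQRWalk.supp (ρB b c) = G.encB M b c) ∧
      -- the partial isometries inside the families
      (∀ b c c', c ≠ c' →
        OQRWalk.IsPartialIsometryBetween (Q b c c') (G.encB M b c) (G.encB M b c') ∧
        ρB b c' = Q b c c' ∘L ρB b c ∘L (Q b c c').adjoint ∧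
        (Q b c c').adjoint ∘L ρB b c' = ρB b c ∘L (Q b c c').adjoint) ∧
      -- the blocks of an arbitrary invariant state
      (∀ ρ, M.IsInvariantState ρ →
        G.block M ρ .zero .zero = 0 ∧
        (∀ a, ∃ t : ℂ, G.block M ρ (.single a) (.single a) = t • ρA a) ∧
        (∀ b c, ∃ t : ℂ, G.block M ρ (.family b c) (.family b c) = t • ρB b c) ∧
        (∀ b c c', c ≠ c' →
          M.IsInvariant (G.block M ρ (.family b c) (.family b c')) ∧
          ∃ t : ℂ, G.block M ρ (.family b c) (.family b c') =
            t • ((Q b c c').adjoint ∘L ρB b c')) ∧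
        (∀ k l : OQRWalk.Block A B C, k ≠ l →
          (∀ b c c', ¬ (k = .family b c ∧ l = .family b c')) → G.block M ρ k l = 0)) ∧
      -- off-diagonal blocks inside a family do occur
      (∀ b c c', c ≠ c' → ∃ ρ, M.IsInvariantState ρ ∧
        G.block M ρ (.family b c) (.family b c') ≠ 0) := by
  choose ρA hρA using fun a => hG.exists_invariantState (k := .single a) (by simp)
  choose ρB hρB using fun b c => hG.exists_invariantState (k := .family b c) (by simp)
  choose Q hQ using hG.exists_isIntertwiner
  -- Conjugation by an intertwiner yields an invariant state supported in the target, and uniqueness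
  -- there identifies it.
  have hconj : ∀ b c c', ρB b c' = Q b c c' * ρB b c * star (Q b c c') := by
    intro b c c'
    have hcl := (hG.isMinimalStable_space (k := .family b c) (by simp)).1.1
    have hcl' := (hG.isMinimalStable_space (k := .family b c') (by simp)).1.1
    refine ((hρB b c').1.2 _ (M.isInvariantState_iff.2 ((hQ b c c').isFixedState_conj M.isStochastic
      (M.isInvariantState_iff.1 (hρB b c).1.1.1) hcl (hρB b c).1.1.2)) ?_).symm
    refine (OQRWalk.supp_le_iff_proj_mul hcl').2 ?_
    rw [← mul_assoc, ← mul_assoc]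
    congr 2
    exact (hQ b c c').proj_mul
  refine ⟨ρA, ρB, Q, hρA, hρB, fun b c c' _ => ⟨⟨(hQ b c c').star_mul_self,
    (hQ b c c').mul_star_self⟩, (hconj b c c').trans (mul_assoc _ _ _), ?_⟩,
    fun ρ hρ => ⟨hG.block_zero_left hρ _,
      fun a => hG.exists_block_self_eq_smul hρ (by simp) (hρA a).1.1.1 (hρA a).1.1.2,
      fun b c => hG.exists_block_self_eq_smul hρ (by simp) (hρB b c).1.1.1 (hρB b c).1.1.2,
      fun b c c' _ => ⟨hG.isInvariant_block hρ (by simp) (by simp),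
        hG.exists_block_eq_smul hρ (by simp) (hρB b c').1.1.1 (hρB b c').1.1.2 (hQ b c c')⟩,
      fun k l hkl hf => hG.block_eq_zero hρ hkl hf⟩,
    fun b c c' hne => hG.exists_block_ne_zero (by simp) (by simp) (by simpa using hne)
      (hρB b c).1.1.1 (hρB b c).1.1.2 (hQ b c c')⟩
  change star (Q b c c') * ρB b c' = ρB b c * star (Q b c c')
  have h1 : OQRWalk.proj (G.encB M b c) * ρB b c = ρB b c :=
    (OQRWalk.supp_le_iff_proj_mul
      (hG.isMinimalStable_space (k := .family b c) (by simp)).1.1).1 (hρB b c).1.1.2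
  rw [hconj b c c', ← mul_assoc, ← mul_assoc, (hQ b c c').star_mul_self, h1]
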